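/- Let $(M,g)$ be a smooth Riemannian manifold (without boundary) of dimension $m\neq 1$, let $p\in M$ and $X\in T_pM$. For $R>0$ let $D_R=\{(x,y)\in\mathbb{R}^2: x^2+y^2<R^2\}$ and $D=D_1$, with the flat metric. A map $u:D_R\to M$ is called harmonic if it is of class $C^2$ and, in all local coordinates of $M$, solves the harmonic map system $$\Delta u^{k}+\sum_{i,j=1}^m\Gamma^{k}_{ij}(u)\left(\frac{\partial u^i}{\partial x}\frac{\partial u^j}{\partial x}+\frac{\partial u^i}{\partial y}\frac{\partial u^j}{\partial y}\right)=0,\qquad k=1,\dots,m,$$ where $\Gamma^k_{ij}$ are the Christoffel symbols of $g$. It is called conformal at $0$ if $g(u_x(0),u_x(0))=g(u_y(0),u_y(0))$ and $g(u_x(0),u_y(0))=0$. Define the real Kobayashi metric by $K_M(p,0)=0$ and, for $X\neq 0$, by $$K_M(p,X)=\inf\left\{\tfrac1R:\ R>0,\ \exists\text{ harmonic map }u:D_R\to M\text{ conformal at }0,\ u(0)=p,\ \tfrac{\partial u}{\partial x}(0)=X\right\},$$ where $\inf\emptyset=\infty$. Then $K_M$ is well defined: for $X\ne 0$ the infimum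 above equals $$\inf\left\{\alpha>0:\ \exists\text{ harmonic map }u:D\to M\text{ conformal at }0,\ u(0)=p,\ \tfrac{\partial u}{\partial x}(0)=\tfrac{X}{\alpha}\right\},$$ and $0\le K_M(p,X)<\infty$ for all $p\in M$ and all $X\in T_pM$. -/

import Mathlib

open scoped Manifold ContDiff

noncomputable section

namespace RealKobayashi

/-- Euclidean `n`-space `ℝⁿ`. -/
abbrev Euc (n : ℕ) : Type := EuclideanSpace ℝ (Fin n)

/-- The `i`-th standard basis vector of `ℝⁿ`. In `ℝ²` the coordinates are `(x, y)`, so that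
`stdVec 2 0` is `∂/∂x` and `stdVec 2 1` is `∂/∂y`. -/
def stdVec (n : ℕ) (i : Fin n) : Euc n := EuclideanSpace.single i (1 : ℝ)

/-- The partial derivative `∂f/∂xⁱ` of a real function on (an open subset of) `ℝⁿ`. -/
def partialDeriv {n : ℕ} (i : Fin n) (f : Euc n → ℝ) (x : Euc n) : ℝ :=
  fderiv ℝ f x (stdVec n i)

section Manifold

variable {m : ℕ} {M : Type*} [TopologicalSpace M] [ChartedSpace (Euc m) M]
  [IsManifold (𝓡 m) ∞ M]

/-- A smooth Riemannian metric on the smooth `m`-dimensional manifold `M`. -/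
abbrev RiemMetric (m : ℕ) (M : Type*) [TopologicalSpace M] [ChartedSpace (Euc m) M]
    [IsManifold (𝓡 m) ∞ M] : Type _ :=
  Bundle.ContMDiffRiemannianMetric (𝓡 m) ∞ (Euc m) (fun q : M => TangentSpace (𝓡 m) q)

/-- The coordinate vector field `∂/∂yⁱ` of the chart `e`, at the point with coordinates `y`. -/
def coordVec (e : OpenPartialHomeomorph M (Euc m)) (i : Fin m) (y : Euc m) :
    TangentSpace (𝓡 m) (e.symm y) :=
  mfderiv (𝓡 m) (𝓡 m) e.symm y (stdVec m i)

/-- The matrix `g_{ij}(y) = g(∂/∂yⁱ, ∂/∂yʲ)` of the metric in the chart `e`. -/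
def metricCoeff (g : RiemMetric m M) (e : OpenPartialHomeomorph M (Euc m)) (y : Euc m) :
    Matrix (Fin m) (Fin m) ℝ :=
  Matrix.of fun i j => g.inner (e.symm y) (coordVec e i y) (coordVec e j y)

/-- The Christoffel symbols of the Levi-Civita connection of `g` in the chart `e`:
`Γ^k_{ij} = ½ ∑_l g^{kl} (∂_i g_{jl} + ∂_j g_{il} - ∂_l g_{ij})`. -/
def christoffel (g : RiemMetric m M) (e : OpenPartialHomeomorph M (Euc m)) (k i j : Fin m)
    (y : Euc m) : ℝ :=
  (1 / 2 : ℝ) * ∑ l, (metricCoeff g e y)⁻¹ k l *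
    (partialDeriv i (fun w => metricCoeff g e w j l) y
      + partialDeriv j (fun w => metricCoeff g e w i l) y
      - partialDeriv l (fun w => metricCoeff g e w i j) y)

/-- The `k`-th component, in the chart `e` of the target, of the tension field at `z` of a map `u`
from (an open subset of) the flat `ℝⁿ` to `(M, g)`:
`Δ uᵏ + ∑_a ∑_{i,j} Γ^k_{ij}(u) ∂_a uⁱ ∂_a uʲ`. -/
def tension {n : ℕ} (g : RiemMetric m M) (e : OpenPartialHomeomorph M (Euc m)) (u : Euc n → M)
    (k : Fin m) (z : Euc n) : ℝ :=
  (Laplacian.laplacian (fun w : Euc n => e (u w) k) : Euc n → ℝ) z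
    + ∑ a : Fin n, ∑ i : Fin m, ∑ j : Fin m, christoffel g e k i j (e (u z)) *
        partialDeriv a (fun w => e (u w) i) z * partialDeriv a (fun w => e (u w) j) z

/-- `u` is a harmonic map from the open subset `s` of the flat `ℝⁿ` to `(M, g)`: it is `C²` on `s`
and solves the harmonic map system in all local coordinates of the target. Only the values of `u`
on `s` matter. -/
def IsHarmonicMapOn {n : ℕ} (g : RiemMetric m M) (u : Euc n → M) (s : Set (Euc n)) : Prop :=
  ContMDiffOn (𝓡 n) (𝓡 m) 2 u s ∧
    ∀ e ∈ atlas (Euc m) M, ∀ z ∈ s, u z ∈ e.source → ∀ k : Fin m, tension g e u k z = 0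

/-- The derivatives `∂u/∂x(0)` (for `a = 0`) and `∂u/∂y(0)` (for `a = 1`). -/
def partialAtZero (u : Euc 2 → M) (a : Fin 2) : TangentSpace (𝓡 m) (u 0) :=
  mfderiv (𝓡 2) (𝓡 m) u 0 (stdVec 2 a)

/-- `u` is conformal at `0`: `g(u_x, u_x) = g(u_y, u_y)` and `g(u_x, u_y) = 0` at `0`. -/
def IsConformalAtZero (g : RiemMetric m M) (u : Euc 2 → M) : Prop :=
  g.inner (u 0) (partialAtZero u 0) (partialAtZero u 0)
      = g.inner (u 0) (partialAtZero u 1) (partialAtZero u 1) ∧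
    g.inner (u 0) (partialAtZero u 0) (partialAtZero u 1) = 0

/-- `u` is a harmonic map from the open disk `D_R` to `(M, g)` that is conformal at `0`, with
`u(0) = p` and `∂u/∂x(0) = X`. The last two conditions are expressed together, as an equality in
the tangent bundle `TM`. -/
def IsAdmissibleDisk (g : RiemMetric m M) (p : M) (X : TangentSpace (𝓡 m) p) (R : ℝ)
    (u : Euc 2 → M) : Prop :=
  IsHarmonicMapOn g u (Metric.ball (0 : Euc 2) R) ∧ IsConformalAtZero g u ∧
    (⟨u 0, partialAtZero u 0⟩ : TangentBundle (𝓡 m) M) = ⟨p, X⟩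

/-- The set of all `α > 0` such that there is a harmonic map `u : D → M` on the unit disk,
conformal at `0`, with `u(0) = p` and `∂u/∂x(0) = X / α`. -/
def unitDiskSet (g : RiemMetric m M) (p : M) (X : TangentSpace (𝓡 m) p) : Set ℝ :=
  {α | 0 < α ∧ ∃ u : Euc 2 → M, IsAdmissibleDisk g p (α⁻¹ • X) 1 u}

/-- The set of all `1 / R`, `R > 0`, such that there is a harmonic map `u : D_R → M`, conformal at
`0`, with `u(0) = p` and `∂u/∂x(0) = X`. -/
def radiusSet (g : RiemMetric m M) (p : M) (X : TangentSpace (𝓡 m) p) : Set ℝ :=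
  {t | ∃ R : ℝ, 0 < R ∧ t = 1 / R ∧ ∃ u : Euc 2 → M, IsAdmissibleDisk g p X R u}

/-- The infimum of a set of real numbers in `[-∞, ∞]`; it is `∞` for the empty set. -/
def extInf (S : Set ℝ) : EReal := sInf ((fun t : ℝ => (t : EReal)) '' S)

open Classical in
/-- The real Kobayashi metric `K_M(p, X)`, a priori an extended real number. -/
def kobayashiMetric (g : RiemMetric m M) (p : M) (X : TangentSpace (𝓡 m) p) : EReal :=
  if X = 0 then 0 else extInf (radiusSet g p X)

end Manifold

end RealKobayashi

end

/-! Rescaling the domain, `u ↦ u (c • ·)`, multiplies the tension by `c ^ 2`, multiplies the first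
derivatives at `0` by `c` and divides the radius by `c`. Hence the two sets of admissible numbers
coincide, not only their infima (`unitDiskSet_eq_radiusSet`). Nonnegativity is immediate, so what
remains is finiteness: for `X ≠ 0` at least one admissible disk must exist.

Since `m ≠ 1`, there is a vector orthogonal to `X` of the same length. It therefore suffices to find
a harmonic disk through `p` whose differential at `0` is a small multiple `ε • l` of a given linear
map, and then to rescale. In a chart, write `U = y₀ + ε w`. The system `ΔU = Q(U, DU)` is quadratic
in `DU`, so it becomes `Δw = ε Q(y₀ + ε w, Dw)` with `w(0) = 0`, `Dw(0) = l`, and the small factor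
`ε` invites a contraction argument (`exists_solution_semilinear`, `exists_solution_quadratic`).

The unknown of the fixed point problem is `f = Δw` in a small `C¹` ball, with `w` recovered from `f`
by the Newtonian potential. The derivative of `gradPotential f` is the potential gradient of the
derivative of `f`, so sup norms of `f` and `Df` control `w` in `C²`. No Hölder spaces or singular
integrals are needed. The identities `trace_fderiv_gradPotential` and `fderiv_gradPotential_symm`
say that the potential does solve the Poisson equation.

Finally, the equation is solved in one chart only. It holds in all charts because the tension with
lowered index transforms as a covector (`covTension_comp`). -/

noncomputable section

namespace RealKobayashi

/-! ### Radial and angular integral identities in polar coordinates -/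

section Polar

open MeasureTheory Set Filter Topology

variable {F : Type*} [NormedAddCommGroup F] [NormedSpace ℝ F]

/-- The integrand is continuous on the closed strip and vanishes for large radius. This licenses
Fubini in the two identities below. -/
theorem polarCoord_integrableOn_fderiv {h : ℂ → F} (hh : ContDiff ℝ 1 h)
    (hc : HasCompactSupport h) (v : ℂ) :
    IntegrableOn (fun p : ℝ × ℝ => fderiv ℝ h (p.1 * Complex.exp (p.2 * Complex.I))
      (v * Complex.exp (p.2 * Complex.I))) (Ioi 0 ×ˢ Ioo (-Real.pi) Real.pi) := by
  obtain ⟨R, hR⟩ := (hc.fderiv ℝ).isCompact.isBounded.subset_closedBall 0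
  have hcont : Continuous (fun p : ℝ × ℝ => fderiv ℝ h (p.1 * Complex.exp (p.2 * Complex.I))
      (v * Complex.exp (p.2 * Complex.I))) := by
    have := hh.continuous_fderiv one_ne_zero
    fun_prop
  have h1 : IntegrableOn (fun p : ℝ × ℝ => fderiv ℝ h (p.1 * Complex.exp (p.2 * Complex.I))
      (v * Complex.exp (p.2 * Complex.I))) (Icc 0 R ×ˢ Icc (-Real.pi) Real.pi) :=
    hcont.continuousOn.integrableOn_compact (isCompact_Icc.prod isCompact_Icc)
  refine (h1.of_forall_sdiff_eq_zero (measurableSet_Ioi.prod measurableSet_Ioo)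
    (t := Ioi 0 ×ˢ Ioo (-Real.pi) Real.pi) ?_)
  rintro ⟨r, θ⟩ ⟨⟨hr, hθ⟩, hn⟩
  have : fderiv ℝ h (r * Complex.exp (θ * Complex.I)) = 0 := by
    refine image_eq_zero_of_notMem_tsupport fun hmem => hn ⟨⟨(mem_Ioi.1 hr).le, ?_⟩, ⟨hθ.1.le, hθ.2.le⟩⟩
    have := hR hmem
    rw [mem_closedBall_zero_iff, norm_mul, Complex.norm_exp_ofReal_mul_I] at this
    simpa [abs_of_pos (mem_Ioi.1 hr)] using this
  simp [this]

/-- The Jacobian `r` and the factor `r` in `v * z` cancel `‖z‖⁻²`. The radial case is `v = 1`, the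
angular case `v = I`. -/
theorem integral_fderiv_polar {h : ℂ → F} (v : ℂ) :
    ∫ z : ℂ, (‖z‖ ^ 2)⁻¹ • fderiv ℝ h z (v * z) =
      ∫ p in Ioi (0 : ℝ) ×ˢ Ioo (-Real.pi) Real.pi,
        fderiv ℝ h (p.1 * Complex.exp (p.2 * Complex.I)) (v * Complex.exp (p.2 * Complex.I)) := by
  rw [← Complex.integral_comp_polarCoord_symm, polarCoord_target]
  refine setIntegral_congr_fun (measurableSet_Ioi.prod measurableSet_Ioo) ?_
  rintro ⟨r, θ⟩ ⟨hr, hθ⟩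
  have hr : 0 < r := hr
  have e1 : Complex.polarCoord.symm (r, θ) = r * Complex.exp (θ * Complex.I) := by
    rw [Complex.polarCoord_symm_apply, Complex.exp_mul_I]; simp
  have e2 : v * (r * Complex.exp (θ * Complex.I)) = r • (v * Complex.exp (θ * Complex.I)) := by
    rw [Complex.real_smul]; ring
  simp only [e1, e2, map_smul, norm_mul, Complex.norm_exp_ofReal_mul_I, mul_one,
    Complex.norm_real, Real.norm_eq_abs, sq_abs, smul_smul]
  rw [show r * ((r ^ 2)⁻¹ * r) = 1 by field_simp, one_smul]

/-- On each ray the integrand is the derivative of `h` along the ray, which integrates to `-h 0`;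
the angles contribute `2π`. -/
theorem integral_radial_fderiv [CompleteSpace F] {h : ℂ → F} (hh : ContDiff ℝ 1 h)
    (hc : HasCompactSupport h) :
    ∫ z : ℂ, (‖z‖ ^ 2)⁻¹ • fderiv ℝ h z z = -(2 * Real.pi) • h 0 := by
  have h1 := integral_fderiv_polar (h := h) 1
  have h2 := polarCoord_integrableOn_fderiv hh hc 1
  simp only [one_mul] at h1 h2
  rw [h1, Measure.volume_eq_prod, ← setIntegral_prod_swap, setIntegral_prod]
  · have key : ∀ θ : ℝ, ∫ r in Ioi (0 : ℝ), fderiv ℝ h (r * Complex.exp (θ * Complex.I))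
        (Complex.exp (θ * Complex.I)) = - h 0 := by
      intro θ
      have hd : ∀ r : ℝ, HasDerivAt (fun r : ℝ => h (r * Complex.exp (θ * Complex.I)))
          (fderiv ℝ h (r * Complex.exp (θ * Complex.I)) (Complex.exp (θ * Complex.I))) r := by
        intro r
        have h3 : HasDerivAt (fun r : ℝ => (r : ℂ) * Complex.exp (θ * Complex.I))
            (Complex.exp (θ * Complex.I)) r := by
          simpa using (Complex.ofRealCLM.hasDerivAt (x := r)).mul_const (Complex.exp (θ * Complex.I))
        exact ((hh.differentiable one_ne_zero _).hasFDerivAt).comp_hasDerivAt r h3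
      have hcd : ContDiff ℝ 1 (fun r : ℝ => h (r * Complex.exp (θ * Complex.I))) := by
        have : ContDiff ℝ 1 (fun r : ℝ => (r : ℂ) * Complex.exp (θ * Complex.I)) :=
          Complex.ofRealCLM.contDiff.mul contDiff_const
        exact hh.comp this
      have hcs : HasCompactSupport (fun r : ℝ => h (r * Complex.exp (θ * Complex.I))) := by
        obtain ⟨R, hR⟩ := hc.isCompact.isBounded.subset_closedBall 0
        refine HasCompactSupport.of_support_subset_isCompact (isCompact_closedBall (0:ℝ) R) ?_
        intro r hr
        have := hR (subset_tsupport _ hr)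
        rw [mem_closedBall_zero_iff, norm_mul, Complex.norm_exp_ofReal_mul_I] at this
        simpa using this
      have := hcs.integral_Ioi_deriv_eq hcd 0
      rw [← integral_congr_ae (Eventually.of_forall fun r => (hd r).deriv), this]
      simp
    simp only [Prod.fst_swap, Prod.snd_swap, key]
    rw [integral_const]
    simp [Real.pi_pos.le, two_mul, add_smul]
  · rw [Measure.volume_eq_prod] at h2
    exact h2.swap

/-- On each circle the integrand is the `θ`-derivative of the periodic function `r⁻¹ • h (r
e^{iθ})`. -/
theorem integral_angular_fderiv [CompleteSpace F] {h : ℂ → F} (hh : ContDiff ℝ 1 h)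
    (hc : HasCompactSupport h) :
    ∫ z : ℂ, (‖z‖ ^ 2)⁻¹ • fderiv ℝ h z (Complex.I * z) = 0 := by
  rw [integral_fderiv_polar, Measure.volume_eq_prod, setIntegral_prod]
  · rw [← integral_zero ℝ F (μ := volume.restrict (Ioi (0 : ℝ)))]
    refine setIntegral_congr_fun measurableSet_Ioi fun r hr => ?_
    have hr : 0 < r := hr
    have hd : ∀ θ : ℝ, HasDerivAt (fun θ : ℝ => r⁻¹ • h (r * Complex.exp (θ * Complex.I)))
        (fderiv ℝ h (r * Complex.exp (θ * Complex.I))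
          (Complex.I * Complex.exp (θ * Complex.I))) θ := by
      intro θ
      have h3 : HasDerivAt (fun θ : ℝ => (r : ℂ) * Complex.exp (θ * Complex.I))
          (r • (Complex.I * Complex.exp (θ * Complex.I))) θ := by
        have := (((Complex.ofRealCLM.hasDerivAt (x := θ)).mul_const Complex.I).cexp).const_mul (r : ℂ)
        convert! this using 1
        simp only [Complex.ofRealCLM_apply, Complex.ofReal_one, one_mul, Complex.real_smul]; ring
      have := (((hh.differentiable one_ne_zero _).hasFDerivAt).comp_hasDerivAt θ h3).const_smul r⁻¹
      convert! this using 1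
      rw [map_smul, smul_smul, inv_mul_cancel₀ hr.ne', one_smul]
    dsimp only
    rw [← integral_Ioc_eq_integral_Ioo, ← intervalIntegral.integral_of_le (by linarith [Real.pi_pos]),
      intervalIntegral.integral_eq_sub_of_hasDerivAt (fun θ _ => hd θ)]
    · have : Complex.exp (((-Real.pi : ℝ) : ℂ) * Complex.I) = Complex.exp ((Real.pi : ℂ) * Complex.I) := by
        rw [Complex.exp_pi_mul_I]; push_cast; rw [neg_mul, Complex.exp_neg, Complex.exp_pi_mul_I]; norm_num
      rw [this, sub_self]
    · apply Continuous.intervalIntegrable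
      have := hh.continuous_fderiv one_ne_zero
      fun_prop
  · rw [← Measure.volume_eq_prod]
    exact polarCoord_integrableOn_fderiv hh hc _

end Polar


/-! ### The gradient of the Newtonian potential -/

section Potential

open MeasureTheory Set Filter Topology

variable {F : Type*} [NormedAddCommGroup F] [NormedSpace ℝ F]

/-- The gradient `y / (2π|y|²)` of the fundamental solution of the Laplacian in the plane, as a
covector. -/
def newtonKernel (y : Euc 2) : Euc 2 →L[ℝ] ℝ := (2 * Real.pi * ‖y‖ ^ 2)⁻¹ • innerSL ℝ y

theorem newtonKernel_apply (y v : Euc 2) :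
    newtonKernel y v = (2 * Real.pi * ‖y‖ ^ 2)⁻¹ * inner ℝ y v := rfl

theorem norm_newtonKernel (y : Euc 2) : ‖newtonKernel y‖ = (2 * Real.pi)⁻¹ * ‖y‖⁻¹ := by
  rw [newtonKernel, norm_smul, innerSL_apply_norm, norm_inv, norm_mul, norm_pow, norm_norm,
    Real.norm_of_nonneg (by positivity)]
  by_cases h : ‖y‖ = 0
  · simp [h]
  · field_simp

theorem norm_newtonKernel_le_one {y : Euc 2} (hy : 1 ≤ ‖y‖) : ‖newtonKernel y‖ ≤ 1 := by
  rw [norm_newtonKernel]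
  have h1 : (2 * Real.pi)⁻¹ ≤ 1 := inv_le_one_of_one_le₀ (by linarith [Real.pi_gt_three])
  have h2 : ‖y‖⁻¹ ≤ 1 := inv_le_one_of_one_le₀ hy
  have h3 : 0 ≤ ‖y‖⁻¹ := by positivity
  nlinarith

theorem measurable_newtonKernel : StronglyMeasurable newtonKernel := by
  apply Measurable.stronglyMeasurable
  unfold newtonKernel
  fun_prop

theorem locallyIntegrable_newtonKernel : LocallyIntegrable newtonKernel volume := by
  refine locallyIntegrable_of_norm_le_rpow (C := (2 * Real.pi)⁻¹) (α := 1) ?_ ?_ ?_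
    measurable_newtonKernel.aestronglyMeasurable
  · simp
  · simp
  · refine Eventually.of_forall fun y => ?_
    rw [norm_newtonKernel, Real.rpow_neg_one]

/-- The gradient of the Newtonian potential of `f`. -/
def gradPotential (f : Euc 2 → F) : Euc 2 → (Euc 2 →L[ℝ] F) :=
  convolution newtonKernel f (ContinuousLinearMap.smulRightL ℝ (Euc 2) F) volume

/-- A bound for the norm of `gradPotential` on functions supported in the disk of radius `R`. -/
def gradPotentialBound (R : ℝ) : ℝ :=
  (∫ y in Metric.ball (0 : Euc 2) 1, ‖newtonKernel y‖) + volume.real (Metric.closedBall (0 : Euc 2) R)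

theorem gradPotentialBound_nonneg (R : ℝ) : 0 ≤ gradPotentialBound R := by
  unfold gradPotentialBound
  positivity

/-- The kernel is integrable on the unit disk and at most `1` outside it, where only those `t`
within `R` of `x` contribute. -/
theorem norm_gradPotential_le {f : Euc 2 → F} {R M : ℝ} (hM : ∀ x, ‖f x‖ ≤ M)
    (hR : ∀ x, R < ‖x‖ → f x = 0) (x : Euc 2) :
    ‖gradPotential f x‖ ≤ gradPotentialBound R * M := by
  have hM0 : 0 ≤ M := (norm_nonneg _).trans (hM 0)
  have hball : IntegrableOn (fun y => ‖newtonKernel y‖) (Metric.ball 0 1) :=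
    ((locallyIntegrable_newtonKernel.integrableOn_isCompact
      (isCompact_closedBall 0 1)).mono_set Metric.ball_subset_closedBall).norm
  have hi1 : Integrable ((Metric.ball (0 : Euc 2) 1).indicator fun y => ‖newtonKernel y‖) :=
    hball.integrable_indicator Metric.isOpen_ball.measurableSet
  have hi2 : Integrable ((Metric.closedBall x R).indicator fun _ : Euc 2 => (1 : ℝ)) :=
    (integrable_indicator_iff Metric.isClosed_closedBall.measurableSet).2
      (integrableOn_const (isCompact_closedBall x R).measure_lt_top.ne)
  have hint := (hi1.add hi2).mul_const M
  have := norm_integral_le_of_norm_le hint (f := fun t => ContinuousLinearMap.smulRightL ℝ (Euc 2) F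
    (newtonKernel t) (f (x - t))) (Eventually.of_forall fun t => ?_)
  · refine this.trans_eq ?_
    rw [integral_mul_const]
    congr 1
    simp only [Pi.add_apply]
    rw [integral_add hi1 hi2,
      integral_indicator Metric.isOpen_ball.measurableSet, integral_indicator
      Metric.isClosed_closedBall.measurableSet, gradPotentialBound]
    congr 1
    simp [Measure.real, Measure.addHaar_closedBall_center]
  · have hn : ‖ContinuousLinearMap.smulRightL ℝ (Euc 2) F (newtonKernel t) (f (x - t))‖ =
        ‖newtonKernel t‖ * ‖f (x - t)‖ := by
      simp [ContinuousLinearMap.smulRightL]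
    rw [hn]
    by_cases ht : R < ‖x - t‖
    · rw [hR _ ht, norm_zero, mul_zero]
      refine mul_nonneg (add_nonneg ?_ ?_) hM0
      · exact indicator_nonneg (fun _ _ => norm_nonneg _) _
      · exact indicator_nonneg (fun _ _ => zero_le_one) _
    · refine mul_le_mul ?_ (hM _) (norm_nonneg _) ?_
      · have ht' : t ∈ Metric.closedBall x R := by
          rw [Metric.mem_closedBall, dist_comm, dist_eq_norm]; exact not_lt.1 ht
        rw [Pi.add_apply, indicator_of_mem ht']
        by_cases h1 : t ∈ Metric.ball (0 : Euc 2) 1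
        · rw [indicator_of_mem h1]; linarith
        · rw [indicator_of_notMem h1, zero_add]
          rw [mem_ball_zero_iff, not_lt] at h1
          exact norm_newtonKernel_le_one h1
      · refine (add_nonneg ?_ ?_)
        · exact indicator_nonneg (fun _ _ => norm_nonneg _) _
        · exact indicator_nonneg (fun _ _ => zero_le_one) _

theorem gradPotential_sub {f g : Euc 2 → F} (hf : Continuous f) (hfc : HasCompactSupport f)
    (hg : Continuous g) (hgc : HasCompactSupport g) :
    gradPotential (f - g) = gradPotential f - gradPotential g := by
  ext1 x
  have h1 := hfc.convolutionExists_right (ContinuousLinearMap.smulRightL ℝ (Euc 2) F)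
    locallyIntegrable_newtonKernel hf x
  have h2 := hgc.convolutionExists_right (ContinuousLinearMap.smulRightL ℝ (Euc 2) F)
    locallyIntegrable_newtonKernel hg x
  simp only [gradPotential, Pi.sub_apply, convolution_def, map_sub]
  exact integral_sub h1 h2

variable {f : Euc 2 → F}

theorem hasFDerivAt_gradPotential (hf : ContDiff ℝ 1 f) (hc : HasCompactSupport f)
    (x : Euc 2) : HasFDerivAt (gradPotential f) (fderiv ℝ (gradPotential f) x) x :=
  (hc.hasFDerivAt_convolution_right _ locallyIntegrable_newtonKernel hf x).differentiableAt.hasFDerivAt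

/-- Differentiating the convolution on the side of `f` leaves the locally integrable kernel
untouched, so second derivatives of the potential are bounded by first derivatives of `f`. -/
theorem fderiv_gradPotential_apply (hf : ContDiff ℝ 1 f) (hc : HasCompactSupport f)
    (x u : Euc 2) : fderiv ℝ (gradPotential f) x u = gradPotential (fun y => fderiv ℝ f y u) x := by
  have h := hc.hasFDerivAt_convolution_right (ContinuousLinearMap.smulRightL ℝ (Euc 2) F)
    locallyIntegrable_newtonKernel hf x
  unfold gradPotential
  rw [h.fderiv]
  exact convolution_precompR_apply _ locallyIntegrable_newtonKernel (hc.fderiv ℝ)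
    (hf.continuous_fderiv one_ne_zero) x u

theorem contDiff_gradPotential (hf : ContDiff ℝ 1 f) (hc : HasCompactSupport f) :
    ContDiff ℝ 1 (gradPotential f) :=
  hc.contDiff_convolution_right _ locallyIntegrable_newtonKernel hf

theorem norm_fderiv_gradPotential_le (hf : ContDiff ℝ 1 f) (hc : HasCompactSupport f)
    {R M : ℝ} (hM : ∀ x, ‖fderiv ℝ f x‖ ≤ M) (hR : ∀ x, R < ‖x‖ → fderiv ℝ f x = 0) (x : Euc 2) :
    ‖fderiv ℝ (gradPotential f) x‖ ≤ gradPotentialBound R * M := by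
  have hM0 : 0 ≤ M := (norm_nonneg _).trans (hM 0)
  refine ContinuousLinearMap.opNorm_le_bound _ (mul_nonneg (gradPotentialBound_nonneg R) hM0) fun u => ?_
  rw [fderiv_gradPotential_apply hf hc, mul_assoc]
  refine norm_gradPotential_le (fun y => ?_) (fun y hy => by simp [hR y hy]) x
  exact (ContinuousLinearMap.le_opNorm _ _).trans (mul_le_mul_of_nonneg_right (hM y) (norm_nonneg _))

theorem gradPotential_apply [CompleteSpace F] (hf : Continuous f) (hc : HasCompactSupport f)
    (x v : Euc 2) :
    Integrable (fun t => newtonKernel t v • f (x - t)) ∧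
    gradPotential f x v = ∫ t, newtonKernel t v • f (x - t) := by
  have h1 := hc.convolutionExists_right (ContinuousLinearMap.smulRightL ℝ (Euc 2) F)
    locallyIntegrable_newtonKernel hf x
  refine ⟨?_, ?_⟩
  · simpa [ContinuousLinearMap.smulRightL] using ContinuousLinearMap.integrable_comp (ContinuousLinearMap.apply ℝ F v) h1
  · rw [gradPotential, convolution_def, ContinuousLinearMap.integral_apply h1]
    rfl

variable [CompleteSpace F]

theorem integral_radial_euclidean (hf : ContDiff ℝ 1 f) (hc : HasCompactSupport f) (x : Euc 2) :
    ∫ t, (‖t‖ ^ 2)⁻¹ • fderiv ℝ f (x - t) t = (2 * Real.pi) • f x := by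
  let ι := Complex.orthonormalBasisOneI.repr
  have hmp := ι.measurePreserving
  rw [← hmp.integral_comp ι.toHomeomorph.measurableEmbedding]
  have hh : ContDiff ℝ 1 (fun z : ℂ => f (x - ι z)) :=
    hf.comp (contDiff_const.sub ι.contDiff)
  have hhc : HasCompactSupport (fun z : ℂ => f (x - ι z)) :=
    hc.comp_homeomorph (ι.toHomeomorph.trans (Homeomorph.subLeft x))
  have h := integral_radial_fderiv hh hhc
  have hd : ∀ z : ℂ, fderiv ℝ (fun z : ℂ => f (x - ι z)) z z = - fderiv ℝ f (x - ι z) (ι z) := by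
    intro z
    have h1 : HasFDerivAt (fun z : ℂ => x - ι z) (-(ι : ℂ →L[ℝ] Euc 2)) z :=
      (ι : ℂ →L[ℝ] Euc 2).hasFDerivAt.const_sub x
    have h2 : HasFDerivAt (fun z : ℂ => f (x - ι z)) _ z :=
      (hf.differentiable one_ne_zero _).hasFDerivAt.comp z h1
    rw [h2.fderiv]
    simp
  simp only [hd, smul_neg, integral_neg, map_zero, sub_zero, neg_smul, neg_inj] at h
  simpa using h

theorem integral_angular_euclidean (hf : ContDiff ℝ 1 f) (hc : HasCompactSupport f) (x : Euc 2) :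
    ∫ t : Euc 2, (‖t‖ ^ 2)⁻¹ • fderiv ℝ f (x - t) (!₂[-t 1, t 0]) = 0 := by
  let ι := Complex.orthonormalBasisOneI.repr
  have hmp := ι.measurePreserving
  rw [← hmp.integral_comp ι.toHomeomorph.measurableEmbedding]
  have hh : ContDiff ℝ 1 (fun z : ℂ => f (x - ι z)) :=
    hf.comp (contDiff_const.sub ι.contDiff)
  have hhc : HasCompactSupport (fun z : ℂ => f (x - ι z)) :=
    hc.comp_homeomorph (ι.toHomeomorph.trans (Homeomorph.subLeft x))
  have h := integral_angular_fderiv hh hhc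
  have hd : ∀ z : ℂ, fderiv ℝ (fun z : ℂ => f (x - ι z)) z (Complex.I * z) =
      - fderiv ℝ f (x - ι z) (!₂[-ι z 1, ι z 0]) := by
    intro z
    have h1 : HasFDerivAt (fun z : ℂ => x - ι z) (-(ι : ℂ →L[ℝ] Euc 2)) z :=
      (ι : ℂ →L[ℝ] Euc 2).hasFDerivAt.const_sub x
    have h2 : HasFDerivAt (fun z : ℂ => f (x - ι z)) _ z :=
      (hf.differentiable one_ne_zero _).hasFDerivAt.comp z h1
    rw [h2.fderiv]
    have : ι (Complex.I * z) = !₂[-ι z 1, ι z 0] := by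
      ext i; fin_cases i <;> simp [ι]
    simp [← this]
  simp only [hd, smul_neg, integral_neg, neg_eq_zero] at h
  simpa using h

/-- This is the Poisson equation. Summed over `i`, the integrands combine to `(2π‖t‖²)⁻¹ Df(x - t)
t`, the radial integral. -/
theorem trace_fderiv_gradPotential (hf : ContDiff ℝ 1 f) (hc : HasCompactSupport f) (x : Euc 2) :
    ∑ i, fderiv ℝ (gradPotential f) x (stdVec 2 i) (stdVec 2 i) = f x := by
  have hci : ∀ u, Continuous fun y => fderiv ℝ f y u := fun u => by
    have := hf.continuous_fderiv one_ne_zero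
    fun_prop
  have hcs : ∀ u, HasCompactSupport fun y => fderiv ℝ f y u := fun u => hc.fderiv_apply ℝ u
  simp only [fderiv_gradPotential_apply hf hc, (gradPotential_apply (hci _) (hcs _) _ _).2]
  rw [← integral_finsetSum _ fun i _ => (gradPotential_apply (hci _) (hcs _) _ _).1]
  have h := integral_radial_euclidean hf hc x
  rw [← inv_smul_smul₀ (show 2 * Real.pi ≠ 0 by positivity) (f x), ← h, ← integral_smul]
  congr 1
  ext1 t
  have ht : fderiv ℝ f (x - t) t = ∑ i, t i • fderiv ℝ f (x - t) (stdVec 2 i) := by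
    simp only [← map_smul, ← map_sum]
    congr 1
    ext i; fin_cases i <;> simp [stdVec]
  rw [ht, Finset.smul_sum, Finset.smul_sum]
  refine Finset.sum_congr rfl fun i _ => ?_
  rw [newtonKernel_apply, smul_smul, smul_smul]
  congr 1
  simp [stdVec, EuclideanSpace.inner_single_right, mul_comm]

/-- The difference of the two integrands applies `Df(x - t)` to `⟨t, v⟩ u - ⟨t, u⟩ v`, which in the
plane is `u 1 * v 0 - u 0 * v 1` times the rotated vector `(-t 1, t 0)`. The angular integral
vanishes. -/
theorem fderiv_gradPotential_symm (hf : ContDiff ℝ 1 f) (hc : HasCompactSupport f) (x u v : Euc 2) :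
    fderiv ℝ (gradPotential f) x u v = fderiv ℝ (gradPotential f) x v u := by
  have hci : ∀ u, Continuous fun y => fderiv ℝ f y u := fun u => by
    have := hf.continuous_fderiv one_ne_zero
    fun_prop
  have hcs : ∀ u, HasCompactSupport fun y => fderiv ℝ f y u := fun u => hc.fderiv_apply ℝ u
  rw [← sub_eq_zero]
  simp only [fderiv_gradPotential_apply hf hc, (gradPotential_apply (hci _) (hcs _) _ _).2]
  rw [← integral_sub (gradPotential_apply (hci _) (hcs _) _ _).1
    (gradPotential_apply (hci _) (hcs _) _ _).1]
  have h := integral_angular_euclidean hf hc x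
  rw [← smul_zero ((2 * Real.pi)⁻¹ * (u 1 * v 0 - u 0 * v 1)), ← h, ← integral_smul]
  congr 1
  ext1 t
  simp only [newtonKernel_apply, mul_smul, ← map_smul, ← map_sub, mul_inv]
  congr 1
  ext i
  fin_cases i <;> simp [PiLp.inner_apply, Fin.sum_univ_two] <;> ring

end Potential


/-! ### Potentials with prescribed `1`-jet, and the `C¹` ball -/

section Fixed

open MeasureTheory Set Filter Topology BoundedContinuousFunction

variable {F : Type*} [NormedAddCommGroup F] [NormedSpace ℝ F]

/-- The gradient of the solution of `Δ w = f` with `w(0) = 0` and `Dw(0) = l`. -/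
def potentialGrad (l : Euc 2 →L[ℝ] F) (f : Euc 2 → F) (x : Euc 2) : Euc 2 →L[ℝ] F :=
  l + gradPotential f x - gradPotential f 0

/-- The solution of `Δ w = f` with `w(0) = 0` and `Dw(0) = l`. -/
def potential (l : Euc 2 →L[ℝ] F) (f : Euc 2 → F) (x : Euc 2) : F :=
  curveIntegral (potentialGrad l f) (Path.segment 0 x)

variable {l : Euc 2 →L[ℝ] F} {f : Euc 2 → F}

theorem potential_zero : potential l f 0 = 0 := by
  simp [potential]

theorem potentialGrad_zero : potentialGrad l f 0 = l := by
  simp [potentialGrad]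

theorem hasFDerivAt_potentialGrad (hf : ContDiff ℝ 1 f) (hc : HasCompactSupport f) (x : Euc 2) :
    HasFDerivAt (potentialGrad l f) (fderiv ℝ (gradPotential f) x) x := by
  have := ((hasFDerivAt_gradPotential hf hc x).const_add l).sub_const (gradPotential f 0)
  exact this

/-- Poincaré lemma: `potentialGrad l f` is a closed `1`-form because its derivative is symmetric, so
integration along segments from `0` gives a primitive. -/
theorem hasFDerivAt_potential [CompleteSpace F] (hf : ContDiff ℝ 1 f) (hc : HasCompactSupport f)
    (x : Euc 2) : HasFDerivAt (potential l f) (potentialGrad l f x) x := by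
  have := convex_univ.hasFDerivWithinAt_curveIntegral_segment_of_hasFDerivWithinAt_symmetric
    (fun x _ => (hasFDerivAt_potentialGrad (l := l) hf hc x).hasFDerivWithinAt)
    (fun a _ u _ v _ => fderiv_gradPotential_symm hf hc a u v) (mem_univ (0 : Euc 2)) (mem_univ x)
  exact hasFDerivWithinAt_univ.1 this

theorem norm_potentialGrad_sub_le {R δ : ℝ} (hM : ∀ x, ‖f x‖ ≤ δ)
    (hR : ∀ x, R < ‖x‖ → f x = 0) (x : Euc 2) :
    ‖potentialGrad l f x - l‖ ≤ 2 * (gradPotentialBound R * δ) := by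
  have h1 := norm_gradPotential_le hM hR x
  have h2 := norm_gradPotential_le hM hR 0
  have : potentialGrad l f x - l = gradPotential f x - gradPotential f 0 := by
    simp [potentialGrad]; abel
  rw [this]
  linarith [norm_sub_le (gradPotential f x) (gradPotential f 0)]

/-- The `C¹` functions on the plane, together with their derivative, that vanish outside the disk of
radius `R` and whose `C¹` norm is at most `δ`. -/
def c1Ball (F : Type*) [NormedAddCommGroup F] [NormedSpace ℝ F] (R δ : ℝ) :
    Set ((Euc 2 →ᵇ F) × (Euc 2 →ᵇ (Euc 2 →L[ℝ] F))) :=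
  {p | (∀ x, HasFDerivAt p.1 (p.2 x) x) ∧ (∀ x, R < ‖x‖ → p.1 x = 0) ∧
    p.1 ∈ Metric.closedBall 0 δ ∧ p.2 ∈ Metric.closedBall 0 δ}

theorem isClosed_hasFDerivAt : IsClosed {p : (Euc 2 →ᵇ F) × (Euc 2 →ᵇ (Euc 2 →L[ℝ] F)) |
    ∀ x, HasFDerivAt p.1 (p.2 x) x} := by
  have : FirstCountableTopology (Euc 2 →ᵇ F) := inferInstance
  have : FirstCountableTopology (Euc 2 →ᵇ (Euc 2 →L[ℝ] F)) :=
    UniformSpace.firstCountableTopology _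
  refine IsSeqClosed.isClosed fun u p hu hp x => ?_
  have hp1 := (continuous_fst.tendsto p).comp hp
  have hp2 := (continuous_snd.tendsto p).comp hp
  rw [BoundedContinuousFunction.tendsto_iff_tendstoUniformly] at hp1 hp2
  exact hasFDerivAt_of_tendstoUniformly hp2 (fun n x => hu n x) (fun x => hp1.tendsto_at x) x

omit [NormedSpace ℝ F] in
theorem isClosed_forall_eq_zero (R : ℝ) :
    IsClosed {f : Euc 2 →ᵇ F | ∀ x, R < ‖x‖ → f x = 0} := by
  simp only [ofPred_forall]
  exact isClosed_iInter fun x => isClosed_iInter fun _ => isClosed_eq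
    (BoundedContinuousFunction.lipschitz_eval_const x).continuous
      continuous_const

/-- Carrying the derivative as a second component places the ball in a product of spaces with the
sup norm. It is closed there because uniform limits commute with differentiation, hence it is
complete when `F` is. -/
theorem isClosed_c1Ball (R δ : ℝ) : IsClosed (c1Ball F R δ) :=
  isClosed_hasFDerivAt.inter (((isClosed_forall_eq_zero R).preimage continuous_fst).inter
    ((Metric.isClosed_closedBall.preimage continuous_fst).inter
      (Metric.isClosed_closedBall.preimage continuous_snd)))

section mem

variable {R δ : ℝ} {p q : (Euc 2 →ᵇ F) × (Euc 2 →ᵇ (Euc 2 →L[ℝ] F))}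

theorem fderiv_of_mem_c1Ball (hp : p ∈ c1Ball F R δ) : fderiv ℝ p.1 = p.2 :=
  funext fun x => (hp.1 x).fderiv

theorem contDiff_of_mem_c1Ball (hp : p ∈ c1Ball F R δ) : ContDiff ℝ 1 p.1 := by
  rw [contDiff_one_iff_fderiv, fderiv_of_mem_c1Ball hp]
  exact ⟨fun x => (hp.1 x).differentiableAt, p.2.continuous⟩

theorem snd_eq_zero_of_mem_c1Ball (hp : p ∈ c1Ball F R δ) {x : Euc 2} (hx : R < ‖x‖) :
    p.2 x = 0 := by
  have : p.1 =ᶠ[𝓝 x] fun _ => 0 := by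
    filter_upwards [(isOpen_lt continuous_const continuous_norm).mem_nhds hx] with y hy
    exact hp.2.1 y hy
  rw [← fderiv_of_mem_c1Ball hp, this.fderiv_eq, fderiv_const_apply]

theorem hasCompactSupport_of_mem_c1Ball (hp : p ∈ c1Ball F R δ) : HasCompactSupport p.1 :=
  HasCompactSupport.intro (isCompact_closedBall 0 R) fun x hx =>
    hp.2.1 x (by simpa using hx)

theorem gradPotential_sub_of_mem_c1Ball (hp : p ∈ c1Ball F R δ) (hq : q ∈ c1Ball F R δ) :
    gradPotential p.1 - gradPotential q.1 = gradPotential (⇑p.1 - ⇑q.1) :=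
  (gradPotential_sub p.1.continuous (hasCompactSupport_of_mem_c1Ball hp) q.1.continuous
    (hasCompactSupport_of_mem_c1Ball hq)).symm

theorem norm_gradPotential_sub_le (hp : p ∈ c1Ball F R δ) (hq : q ∈ c1Ball F R δ) (x : Euc 2) :
    ‖gradPotential p.1 x - gradPotential q.1 x‖ ≤ gradPotentialBound R * dist p q := by
  rw [← Pi.sub_apply, gradPotential_sub_of_mem_c1Ball hp hq]
  refine norm_gradPotential_le (fun y => ?_) (fun y hy => ?_) x
  · rw [Pi.sub_apply, ← dist_eq_norm]
    exact (BoundedContinuousFunction.dist_coe_le_dist y).trans (le_max_left _ _)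
  · rw [Pi.sub_apply, hp.2.1 y hy, hq.2.1 y hy, sub_zero]

theorem norm_fderiv_gradPotential_sub_le (hp : p ∈ c1Ball F R δ) (hq : q ∈ c1Ball F R δ)
    (x : Euc 2) : ‖fderiv ℝ (gradPotential p.1) x - fderiv ℝ (gradPotential q.1) x‖ ≤
      gradPotentialBound R * dist p q := by
  have hp' := contDiff_of_mem_c1Ball hp
  have hq' := contDiff_of_mem_c1Ball hq
  have hd : ∀ y, fderiv ℝ (⇑p.1 - ⇑q.1) y = p.2 y - q.2 y := fun y =>
    ((hp.1 y).sub (hq.1 y)).fderiv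
  rw [← fderiv_sub (hasFDerivAt_gradPotential hp' (hasCompactSupport_of_mem_c1Ball hp) x).differentiableAt
    (hasFDerivAt_gradPotential hq' (hasCompactSupport_of_mem_c1Ball hq) x).differentiableAt,
    gradPotential_sub_of_mem_c1Ball hp hq]
  refine norm_fderiv_gradPotential_le (f := ⇑p.1 - ⇑q.1) (hp'.sub hq') ?_ (fun y => ?_) (fun y hy => ?_) x
  · exact HasCompactSupport.intro (isCompact_closedBall 0 R) fun x hx => by
      have hx : R < ‖x‖ := by simpa using hx
      rw [Pi.sub_apply, hp.2.1 x hx, hq.2.1 x hx, sub_zero]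
  · rw [hd, ← dist_eq_norm]
    exact (BoundedContinuousFunction.dist_coe_le_dist y).trans (le_max_right _ _)
  · rw [hd, snd_eq_zero_of_mem_c1Ball hp hy, snd_eq_zero_of_mem_c1Ball hq hy, sub_zero]

theorem norm_potentialGrad_sub_potentialGrad_le (hp : p ∈ c1Ball F R δ) (hq : q ∈ c1Ball F R δ)
    (x : Euc 2) : ‖potentialGrad l p.1 x - potentialGrad l q.1 x‖ ≤
      2 * gradPotentialBound R * dist p q := by
  have h : potentialGrad l p.1 x - potentialGrad l q.1 x =
    (gradPotential p.1 x - gradPotential q.1 x) - (gradPotential p.1 0 - gradPotential q.1 0) := by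
    simp only [potentialGrad]; abel
  rw [h]
  linarith [norm_sub_le (gradPotential p.1 x - gradPotential q.1 x)
    (gradPotential p.1 0 - gradPotential q.1 0), norm_gradPotential_sub_le hp hq x,
    norm_gradPotential_sub_le hp hq 0]

theorem norm_potential_sub_potential_le [CompleteSpace F] (hp : p ∈ c1Ball F R δ)
    (hq : q ∈ c1Ball F R δ) (x : Euc 2) :
    ‖potential l p.1 x - potential l q.1 x‖ ≤ 2 * gradPotentialBound R * dist p q * ‖x‖ := by
  have := Convex.norm_image_sub_le_of_norm_hasFDerivWithin_le (s := univ)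
    (fun y _ => ((hasFDerivAt_potential (l := l) (contDiff_of_mem_c1Ball hp)
      (hasCompactSupport_of_mem_c1Ball hp) y).sub (hasFDerivAt_potential (l := l)
        (contDiff_of_mem_c1Ball hq)
      (hasCompactSupport_of_mem_c1Ball hq) y)).hasFDerivWithinAt)
    (fun y _ => norm_potentialGrad_sub_potentialGrad_le hp hq y) convex_univ (mem_univ 0) (mem_univ x)
  simpa [potential_zero] using this

end mem

end Fixed


/-! ### The contraction argument for `Δw = ε H(x, w, Dw)` -/

section Semilinear

open MeasureTheory Set Filter Topology BoundedContinuousFunction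

variable {F : Type*} [NormedAddCommGroup F] [NormedSpace ℝ F]

/-- A right-hand side `H(x, w, Dw)` which is `C¹` and vanishes for `x` outside the disk of radius
`R`, such that `H` and `DH` are bounded by `C` and `DH` is Lipschitz with constant `C`. -/
structure IsTame (H : Euc 2 × F × (Euc 2 →L[ℝ] F) → F) (R C : ℝ) : Prop where
  contDiff : ContDiff ℝ 1 H
  norm_le : ∀ j, ‖H j‖ ≤ C
  norm_fderiv_le : ∀ j, ‖fderiv ℝ H j‖ ≤ C
  norm_fderiv_sub_le : ∀ j j', ‖fderiv ℝ H j - fderiv ℝ H j'‖ ≤ C * ‖j - j'‖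
  eq_zero : ∀ j, R < ‖j.1‖ → H j = 0

namespace IsTame

variable {H : Euc 2 × F × (Euc 2 →L[ℝ] F) → F} {R C : ℝ}

theorem norm_sub_le (hH : IsTame H R C) (j j' : Euc 2 × F × (Euc 2 →L[ℝ] F)) :
    ‖H j - H j'‖ ≤ C * ‖j - j'‖ :=
  convex_univ.norm_image_sub_le_of_norm_fderiv_le
    (fun x _ => hH.contDiff.differentiable one_ne_zero x) (fun x _ => hH.norm_fderiv_le x)
    (mem_univ j') (mem_univ j)

theorem fderiv_eq_zero (hH : IsTame H R C) {j : Euc 2 × F × (Euc 2 →L[ℝ] F)} (hj : R < ‖j.1‖) :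
    fderiv ℝ H j = 0 := by
  have : H =ᶠ[𝓝 j] fun _ => 0 := by
    filter_upwards [(isOpen_lt continuous_const continuous_fst.norm).mem_nhds hj] with y hy
    exact hH.eq_zero y hy
  rw [this.fderiv_eq, fderiv_const_apply]

theorem nonneg (hH : IsTame H R C) : 0 ≤ C := (norm_nonneg _).trans (hH.norm_le 0)

end IsTame

/-- The triple `(x, w(x), Dw(x))` for the solution `w` of `Δ w = f`. -/
def jet (l : Euc 2 →L[ℝ] F) (f : Euc 2 → F) (x : Euc 2) : Euc 2 × F × (Euc 2 →L[ℝ] F) :=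
  (x, potential l f x, potentialGrad l f x)

/-- The derivative of `jet l f`. -/
def jetDeriv (l : Euc 2 →L[ℝ] F) (f : Euc 2 → F) (x : Euc 2) :
    Euc 2 →L[ℝ] Euc 2 × F × (Euc 2 →L[ℝ] F) :=
  (ContinuousLinearMap.id ℝ (Euc 2)).prod
    ((potentialGrad l f x).prod (fderiv ℝ (gradPotential f) x))

variable {l : Euc 2 →L[ℝ] F} {f : Euc 2 → F}

theorem hasFDerivAt_jet [CompleteSpace F] (hf : ContDiff ℝ 1 f) (hc : HasCompactSupport f)
    (x : Euc 2) : HasFDerivAt (jet l f) (jetDeriv l f x) x :=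
  (hasFDerivAt_id x).prodMk ((hasFDerivAt_potential hf hc x).prodMk
    (hasFDerivAt_potentialGrad hf hc x))

theorem continuous_jet [CompleteSpace F] (hf : ContDiff ℝ 1 f) (hc : HasCompactSupport f) :
    Continuous (jet l f) :=
  continuous_iff_continuousAt.2 fun x => (hasFDerivAt_jet hf hc x).continuousAt

theorem continuous_jetDeriv (hf : ContDiff ℝ 1 f) (hc : HasCompactSupport f) :
    Continuous (jetDeriv l f) := by
  have h1 : Continuous (potentialGrad l f) :=
    continuous_iff_continuousAt.2 fun x => (hasFDerivAt_potentialGrad hf hc x).continuousAt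
  have h2 : Continuous (fderiv ℝ (gradPotential f)) :=
    (contDiff_gradPotential hf hc).continuous_fderiv one_ne_zero
  exact (ContinuousLinearMap.prodₗᵢ ℝ).continuous.comp
    (continuous_const.prodMk ((ContinuousLinearMap.prodₗᵢ ℝ).continuous.comp (h1.prodMk h2)))

variable {R δ : ℝ} {p q : (Euc 2 →ᵇ F) × (Euc 2 →ᵇ (Euc 2 →L[ℝ] F))}

theorem norm_fst_le_of_mem_c1Ball (hp : p ∈ c1Ball F R δ) (x : Euc 2) : ‖p.1 x‖ ≤ δ :=
  (p.1.norm_coe_le_norm x).trans (mem_closedBall_zero_iff.1 hp.2.2.1)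

theorem norm_snd_le_of_mem_c1Ball (hp : p ∈ c1Ball F R δ) (x : Euc 2) : ‖p.2 x‖ ≤ δ :=
  (p.2.norm_coe_le_norm x).trans (mem_closedBall_zero_iff.1 hp.2.2.2)

theorem norm_potentialGrad_sub_le_one (hp : p ∈ c1Ball F R δ)
    (hδ : 2 * (gradPotentialBound R * δ) ≤ 1) (x : Euc 2) : ‖potentialGrad l p.1 x - l‖ ≤ 1 :=
  (norm_potentialGrad_sub_le (norm_fst_le_of_mem_c1Ball hp) hp.2.1 x).trans hδ

theorem norm_jetDeriv_le (hp : p ∈ c1Ball F R δ) (hδ : 2 * (gradPotentialBound R * δ) ≤ 1)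
    (x : Euc 2) : ‖jetDeriv l p.1 x‖ ≤ ‖l‖ + 1 := by
  have h0 : 0 ≤ gradPotentialBound R * δ := mul_nonneg (gradPotentialBound_nonneg R)
    ((norm_nonneg _).trans (norm_fst_le_of_mem_c1Ball hp 0))
  have h1 : ‖potentialGrad l p.1 x‖ ≤ ‖l‖ + 1 := by
    have := norm_le_norm_add_norm_sub' (potentialGrad l p.1 x) l
    linarith [norm_potentialGrad_sub_le_one (l := l) hp hδ x]
  have h2 : ‖fderiv ℝ (gradPotential p.1) x‖ ≤ ‖l‖ + 1 := by
    have := norm_fderiv_gradPotential_le (contDiff_of_mem_c1Ball hp)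
      (hasCompactSupport_of_mem_c1Ball hp) (R := R) (M := δ)
      (by rw [fderiv_of_mem_c1Ball hp]; exact norm_snd_le_of_mem_c1Ball hp)
      (by rw [fderiv_of_mem_c1Ball hp]; exact fun x hx => snd_eq_zero_of_mem_c1Ball hp hx) x
    linarith [norm_nonneg l]
  rw [jetDeriv, ContinuousLinearMap.opNorm_prod, Prod.norm_def]
  refine max_le ?_ ?_
  · exact ContinuousLinearMap.norm_id_le.trans (by linarith [norm_nonneg l])
  · show ‖(potentialGrad l p.1 x).prod (fderiv ℝ (gradPotential p.1) x)‖ ≤ ‖l‖ + 1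
    rw [ContinuousLinearMap.opNorm_prod, Prod.norm_def]
    exact max_le h1 h2

/-- The difference of potentials grows linearly in `‖x‖`, so the bound is restricted to the disk of
radius `R`. Outside it `H` vanishes. -/
theorem norm_jet_sub_le [CompleteSpace F] (hp : p ∈ c1Ball F R δ) (hq : q ∈ c1Ball F R δ)
    (hR : 0 ≤ R) {x : Euc 2} (hx : ‖x‖ ≤ R) :
    ‖jet l p.1 x - jet l q.1 x‖ ≤ 2 * gradPotentialBound R * (R + 1) * dist p q := by
  have hc := gradPotentialBound_nonneg R
  have hc' : 0 ≤ 2 * gradPotentialBound R * dist p q := by positivity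
  have h1 := norm_potential_sub_potential_le (l := l) hp hq x
  have h2 := norm_potentialGrad_sub_potentialGrad_le (l := l) hp hq x
  rw [jet, jet, Prod.mk_sub_mk, Prod.mk_sub_mk, sub_self, Prod.norm_def, Prod.norm_def]
  simp only [norm_zero]
  refine max_le (by positivity) (max_le ?_ ?_)
  · have := mul_le_mul_of_nonneg_left hx hc'
    linarith
  · have := mul_nonneg hc' hR
    linarith

theorem norm_jetDeriv_sub_le (hp : p ∈ c1Ball F R δ) (hq : q ∈ c1Ball F R δ) (x : Euc 2) :
    ‖jetDeriv l p.1 x - jetDeriv l q.1 x‖ ≤ 2 * gradPotentialBound R * dist p q := by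
  have hc := gradPotentialBound_nonneg R
  have hc' : 0 ≤ gradPotentialBound R * dist p q := by positivity
  have h1 := norm_potentialGrad_sub_potentialGrad_le (l := l) hp hq x
  have h2 := norm_fderiv_gradPotential_sub_le hp hq x
  have : jetDeriv l p.1 x - jetDeriv l q.1 x = (0 : Euc 2 →L[ℝ] Euc 2).prod
      ((potentialGrad l p.1 x - potentialGrad l q.1 x).prod
        (fderiv ℝ (gradPotential p.1) x - fderiv ℝ (gradPotential q.1) x)) := by
    ext1 v
    simp [jetDeriv]
  rw [this, ContinuousLinearMap.opNorm_prod, Prod.norm_def]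
  refine max_le (by simp only [norm_zero]; positivity) ?_
  show ‖(potentialGrad l p.1 x - potentialGrad l q.1 x).prod
        (fderiv ℝ (gradPotential p.1) x - fderiv ℝ (gradPotential q.1) x)‖ ≤ _
  rw [ContinuousLinearMap.opNorm_prod, Prod.norm_def]
  exact max_le h1 (by show ‖fderiv ℝ (gradPotential p.1) x - fderiv ℝ (gradPotential q.1) x‖ ≤ _; linarith)

variable [CompleteSpace F] {H : Euc 2 × F × (Euc 2 →L[ℝ] F) → F} {C ε : ℝ}

/-- The iteration `f ↦ ε H(x, w, Dw)` maps the ball to itself without loss of regularity: `f` of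
class `C¹` gives `w` of class `C²`, so the right-hand side is again `C¹`. -/
theorem exists_mem_c1Ball_eq (hH : IsTame H R C) (hp : p ∈ c1Ball F R δ)
    (hδ : 2 * (gradPotentialBound R * δ) ≤ 1) (hε : |ε| * (C * (‖l‖ + 1)) ≤ δ) :
    ∃ q ∈ c1Ball F R δ, (∀ x, q.1 x = ε • H (jet l p.1 x)) ∧
      ∀ x, q.2 x = ε • (fderiv ℝ H (jet l p.1 x)).comp (jetDeriv l p.1 x) := by
  have hp1 := contDiff_of_mem_c1Ball hp
  have hp2 := hasCompactSupport_of_mem_c1Ball hp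
  have hC := hH.nonneg
  have hδ0 : 0 ≤ δ := (norm_nonneg _).trans (norm_fst_le_of_mem_c1Ball hp 0)
  have hd : ∀ x, HasFDerivAt (fun x => ε • H (jet l p.1 x))
      (ε • (fderiv ℝ H (jet l p.1 x)).comp (jetDeriv l p.1 x)) x := fun x =>
    ((hH.contDiff.differentiable one_ne_zero _).hasFDerivAt.comp x
      (hasFDerivAt_jet hp1 hp2 x)).const_smul ε
  have hb1 : ∀ x, ‖ε • H (jet l p.1 x)‖ ≤ δ := fun x => by
    rw [norm_smul, Real.norm_eq_abs]
    refine le_trans (mul_le_mul_of_nonneg_left ?_ (abs_nonneg ε)) hε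
    nlinarith [hH.norm_le (jet l p.1 x), norm_nonneg l, mul_nonneg hC (norm_nonneg l)]
  have hb2 : ∀ x, ‖ε • (fderiv ℝ H (jet l p.1 x)).comp (jetDeriv l p.1 x)‖ ≤ δ := fun x => by
    rw [norm_smul, Real.norm_eq_abs]
    refine le_trans (mul_le_mul_of_nonneg_left ?_ (abs_nonneg ε)) hε
    exact (ContinuousLinearMap.opNorm_comp_le _ _).trans
      (mul_le_mul (hH.norm_fderiv_le _) (norm_jetDeriv_le hp hδ x) (norm_nonneg _) hC)
  have hcont2 : Continuous fun x => ε • (fderiv ℝ H (jet l p.1 x)).comp (jetDeriv l p.1 x) :=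
    (((hH.contDiff.continuous_fderiv one_ne_zero).comp (continuous_jet hp1 hp2)).clm_comp
      (continuous_jetDeriv hp1 hp2)).const_smul ε
  refine ⟨(BoundedContinuousFunction.ofNormedAddCommGroup _
      (continuous_iff_continuousAt.2 fun x => (hd x).continuousAt) δ hb1,
    BoundedContinuousFunction.ofNormedAddCommGroup _ hcont2 δ hb2), ⟨hd, fun x hx => ?_, ?_, ?_⟩,
    fun x => rfl, fun x => rfl⟩
  · show ε • H (jet l p.1 x) = 0
    rw [hH.eq_zero (jet l p.1 x) hx, smul_zero]
  · exact mem_closedBall_zero_iff.2 (BoundedContinuousFunction.norm_ofNormedAddCommGroup_le _ hδ0 hb1)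
  · exact mem_closedBall_zero_iff.2 (BoundedContinuousFunction.norm_ofNormedAddCommGroup_le _ hδ0 hb2)

theorem norm_smul_jet_sub_le (hH : IsTame H R C) (hR : 0 ≤ R) (hp : p ∈ c1Ball F R δ)
    (hq : q ∈ c1Ball F R δ) (x : Euc 2) :
    ‖ε • H (jet l p.1 x) - ε • H (jet l q.1 x)‖ ≤
      |ε| * (C * (2 * gradPotentialBound R * (R + 1))) * dist p q := by
  have hC := hH.nonneg
  have hc := gradPotentialBound_nonneg R
  rw [← smul_sub, norm_smul, Real.norm_eq_abs, mul_assoc]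
  refine mul_le_mul_of_nonneg_left ?_ (abs_nonneg ε)
  rw [mul_assoc]
  by_cases hx : ‖x‖ ≤ R
  · exact (hH.norm_sub_le _ _).trans
      (mul_le_mul_of_nonneg_left (norm_jet_sub_le hp hq hR hx) hC)
  · rw [hH.eq_zero (jet l p.1 x) (not_le.1 hx), hH.eq_zero (jet l q.1 x) (not_le.1 hx), sub_zero,
      norm_zero]
    positivity

theorem norm_smul_comp_jetDeriv_sub_le (hH : IsTame H R C) (hR : 0 ≤ R) (hp : p ∈ c1Ball F R δ)
    (hq : q ∈ c1Ball F R δ) (hδ : 2 * (gradPotentialBound R * δ) ≤ 1) (x : Euc 2) :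
    ‖ε • (fderiv ℝ H (jet l p.1 x)).comp (jetDeriv l p.1 x) -
        ε • (fderiv ℝ H (jet l q.1 x)).comp (jetDeriv l q.1 x)‖ ≤
      |ε| * (C * (2 * gradPotentialBound R * (R + 1)) * (‖l‖ + 2)) * dist p q := by
  have hC := hH.nonneg
  have hc := gradPotentialBound_nonneg R
  rw [← smul_sub, norm_smul, Real.norm_eq_abs, mul_assoc]
  refine mul_le_mul_of_nonneg_left ?_ (abs_nonneg ε)
  by_cases hx : ‖x‖ ≤ R
  -- Change one factor at a time. The first term uses that `DH` is Lipschitz, the second that it is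
  -- bounded.
  · have e : (fderiv ℝ H (jet l p.1 x)).comp (jetDeriv l p.1 x) -
        (fderiv ℝ H (jet l q.1 x)).comp (jetDeriv l q.1 x) =
        (fderiv ℝ H (jet l p.1 x) - fderiv ℝ H (jet l q.1 x)).comp (jetDeriv l p.1 x) +
        (fderiv ℝ H (jet l q.1 x)).comp (jetDeriv l p.1 x - jetDeriv l q.1 x) := by
      rw [ContinuousLinearMap.sub_comp, ContinuousLinearMap.comp_sub]; abel
    have h1 : ‖(fderiv ℝ H (jet l p.1 x) - fderiv ℝ H (jet l q.1 x)).comp (jetDeriv l p.1 x)‖ ≤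
        C * (2 * gradPotentialBound R * (R + 1) * dist p q) * (‖l‖ + 1) :=
      (ContinuousLinearMap.opNorm_comp_le _ _).trans (mul_le_mul
        ((hH.norm_fderiv_sub_le _ _).trans
          (mul_le_mul_of_nonneg_left (norm_jet_sub_le hp hq hR hx) hC))
        (norm_jetDeriv_le hp hδ x) (norm_nonneg _) (by positivity))
    have h2 : ‖(fderiv ℝ H (jet l q.1 x)).comp (jetDeriv l p.1 x - jetDeriv l q.1 x)‖ ≤
        C * (2 * gradPotentialBound R * dist p q) :=
      (ContinuousLinearMap.opNorm_comp_le _ _).trans (mul_le_mul (hH.norm_fderiv_le _)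
        (norm_jetDeriv_sub_le hp hq x) (norm_nonneg _) hC)
    rw [e]
    refine (norm_add_le _ _).trans ((add_le_add h1 h2).trans ?_)
    have h3 : 0 ≤ C * (2 * gradPotentialBound R * dist p q) * R := by positivity
    linarith
  · rw [hH.fderiv_eq_zero (j := jet l p.1 x) (not_le.1 hx),
      hH.fderiv_eq_zero (j := jet l q.1 x) (not_le.1 hx)]
    simp only [ContinuousLinearMap.zero_comp, sub_zero, norm_zero]
    positivity

theorem exists_fixedPoint_of_dist_le {α : Type*} [MetricSpace α] [CompleteSpace α] [Nonempty α]
    {f : α → α} (hf : ∀ x y, dist (f x) (f y) ≤ 1 / 2 * dist x y) : ∃ x, f x = x := by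
  have h : ContractingWith (1 / 2) f := by
    refine ⟨by rw [← NNReal.coe_lt_coe]; norm_num, LipschitzWith.of_dist_le_mul fun p q => ?_⟩
    simpa using hf p q
  exact ⟨h.fixedPoint, h.fixedPoint_isFixedPt⟩

theorem exists_fixedPoint_c1Ball (hH : IsTame H R C) (hR : 0 ≤ R) (hδ0 : 0 ≤ δ)
    (hδ : 2 * (gradPotentialBound R * δ) ≤ 1) (hε : |ε| * (C * (‖l‖ + 1)) ≤ δ)
    (hε' : |ε| * (C * (2 * gradPotentialBound R * (R + 1)) * (‖l‖ + 2)) ≤ 1 / 2) :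
    ∃ p ∈ c1Ball F R δ, ∀ x, p.1 x = ε • H (jet l p.1 x) := by
  have : CompleteSpace (c1Ball F R δ) := (isClosed_c1Ball R δ).completeSpace_coe
  have h0 : (0 : (Euc 2 →ᵇ F) × (Euc 2 →ᵇ (Euc 2 →L[ℝ] F))) ∈ c1Ball F R δ :=
    ⟨fun x => hasFDerivAt_const _ x, fun _ _ => rfl, Metric.mem_closedBall_self hδ0,
      Metric.mem_closedBall_self hδ0⟩
  have : Nonempty (c1Ball F R δ) := ⟨⟨0, h0⟩⟩
  choose Φ hΦ hΦ1 hΦ2 using fun p : c1Ball F R δ => exists_mem_c1Ball_eq hH p.2 hδ hε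
  obtain ⟨p, hp⟩ := exists_fixedPoint_of_dist_le (f := fun p => (⟨Φ p, hΦ p⟩ : c1Ball F R δ))
    fun p q => by
    have hb : |ε| * (C * (2 * gradPotentialBound R * (R + 1)) * (‖l‖ + 2)) * dist p.1 q.1 ≤
        1 / 2 * dist p.1 q.1 := mul_le_mul_of_nonneg_right hε' dist_nonneg
    have hC := hH.nonneg
    have hc := gradPotentialBound_nonneg R
    have hnn : 0 ≤ 1 / 2 * dist p.1 q.1 := by positivity
    rw [Subtype.dist_eq, Subtype.dist_eq, Prod.dist_eq]
    refine max_le ((BoundedContinuousFunction.dist_le hnn).2 fun x => ?_)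
      ((BoundedContinuousFunction.dist_le hnn).2 fun x => ?_)
    · rw [hΦ1, hΦ1, dist_eq_norm]
      refine (norm_smul_jet_sub_le hH hR p.2 q.2 x).trans (le_trans ?_ hb)
      refine mul_le_mul_of_nonneg_right (mul_le_mul_of_nonneg_left ?_ (abs_nonneg _)) dist_nonneg
      -- The factor `‖l‖ + 2 ≥ 1` lets the contraction constant of the derivative component serve
      -- for the values too.
      exact le_mul_of_one_le_right (by positivity) (by linarith [norm_nonneg l])
    · rw [hΦ2, hΦ2, dist_eq_norm]
      exact (norm_smul_comp_jetDeriv_sub_le hH hR p.2 q.2 hδ x).trans hb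
  refine ⟨p.1, p.2, fun x => ?_⟩
  conv_lhs => rw [← hp]
  exact hΦ1 _ x

/-- Local solvability of a semilinear Poisson system in the plane, with prescribed `1`-jet
at the origin. -/
theorem exists_solution_semilinear (l : Euc 2 →L[ℝ] F) {R : ℝ} (hR : 0 ≤ R) {C : ℝ} (hC : 0 ≤ C) :
    ∃ ε₀ > 0, ∀ ε : ℝ, |ε| ≤ ε₀ → ∀ H : Euc 2 × F × (Euc 2 →L[ℝ] F) → F, IsTame H R C →
      ∃ w : Euc 2 → F, ContDiff ℝ 2 w ∧ w 0 = 0 ∧ fderiv ℝ w 0 = l ∧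
        (∀ x, ‖fderiv ℝ w x - l‖ ≤ 1) ∧
        ∀ x, ∑ i, fderiv ℝ (fderiv ℝ w) x (stdVec 2 i) (stdVec 2 i) =
          ε • H (x, w x, fderiv ℝ w x) := by
  have hc := gradPotentialBound_nonneg R
  -- This radius keeps `Dw` within distance `1` of `l` throughout the ball.
  set δ : ℝ := 1 / (2 * (gradPotentialBound R + 1)) with hδ
  have hδ0 : 0 < δ := by positivity
  have hδ1 : 2 * (gradPotentialBound R * δ) ≤ 1 := by
    rw [hδ]; field_simp; linarith
  set A := C * (‖l‖ + 1) with hA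
  set B := C * (2 * gradPotentialBound R * (R + 1)) * (‖l‖ + 2) with hB
  have hA0 : 0 ≤ A := by positivity
  have hB0 : 0 ≤ B := by positivity
  -- The first bound makes the iteration preserve the ball, the second makes it a contraction with
  -- constant `1 / 2`.
  refine ⟨min (δ / (A + 1)) (1 / (2 * (B + 1))), by positivity, fun ε hε H hH => ?_⟩
  have h1 : |ε| * A ≤ δ := by
    have : |ε| * (A + 1) ≤ δ := (le_div_iff₀ (by positivity)).1 (hε.trans (min_le_left _ _))
    nlinarith [abs_nonneg ε]
  have h2 : |ε| * B ≤ 1 / 2 := by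
    have : |ε| * (2 * (B + 1)) ≤ 1 := (le_div_iff₀ (by positivity)).1 (hε.trans (min_le_right _ _))
    nlinarith [abs_nonneg ε]
  obtain ⟨p, hp, hfix⟩ := exists_fixedPoint_c1Ball (l := l) hH hR hδ0.le hδ1 h1 h2
  have hp1 := contDiff_of_mem_c1Ball hp
  have hp2 := hasCompactSupport_of_mem_c1Ball hp
  have hw : fderiv ℝ (potential l p.1) = potentialGrad l p.1 :=
    funext fun x => (hasFDerivAt_potential hp1 hp2 x).fderiv
  refine ⟨potential l p.1, ?_, potential_zero, ?_, ?_, ?_⟩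
  · rw [show (2 : WithTop ℕ∞) = 1 + 1 by norm_num, contDiff_succ_iff_fderiv]
    refine ⟨fun x => (hasFDerivAt_potential hp1 hp2 x).differentiableAt, by simp, ?_⟩
    rw [hw]
    exact (contDiff_const.add (contDiff_gradPotential hp1 hp2)).sub contDiff_const
  · rw [hw, potentialGrad_zero]
  · rw [hw]
    exact norm_potentialGrad_sub_le_one hp hδ1
  · intro x
    rw [hw, (hasFDerivAt_potentialGrad hp1 hp2 x).fderiv, trace_fderiv_gradPotential hp1 hp2]
    exact hfix x

end Semilinear


/-! ### Invariance of the lowered tension under change of coordinates -/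

section CovariantTension

open Set Filter Topology

variable {n : ℕ} {E E' : Type*} [NormedAddCommGroup E] [NormedSpace ℝ E]
  [NormedAddCommGroup E'] [NormedSpace ℝ E']

/-- The trace of the second derivative. -/
def traceHessian (U : Euc n → E) (z : Euc n) : E :=
  ∑ a, fderiv ℝ (fderiv ℝ U) z (stdVec n a) (stdVec n a)

/-- The tension field of a map into an open subset of `E` with metric `G`, lowered to a covector
by means of `G`. -/
def covTension (G : E → E →L[ℝ] E →L[ℝ] ℝ) (U : Euc n → E) (z : Euc n) : E →L[ℝ] ℝ :=
  G (U z) (traceHessian U z) + ∑ a, (fderiv ℝ G (U z) (fderiv ℝ U z (stdVec n a))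
      (fderiv ℝ U z (stdVec n a)) -
    (1 / 2 : ℝ) • ((fderiv ℝ G (U z)).flip (fderiv ℝ U z (stdVec n a))).flip
      (fderiv ℝ U z (stdVec n a)))

theorem covTension_apply (G : E → E →L[ℝ] E →L[ℝ] ℝ) (U : Euc n → E) (z : Euc n) (c : E) :
    covTension G U z c = G (U z) (traceHessian U z) c +
      ∑ a, (fderiv ℝ G (U z) (fderiv ℝ U z (stdVec n a)) (fderiv ℝ U z (stdVec n a)) c -
        (1 / 2 : ℝ) * fderiv ℝ G (U z) c (fderiv ℝ U z (stdVec n a))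
          (fderiv ℝ U z (stdVec n a))) := by
  simp [covTension]

theorem fderiv_fderiv_comp_apply {φ : E → E'} {U : Euc n → E} {z : Euc n}
    (hφ : ContDiffAt ℝ 2 φ (U z)) (hU : ContDiffAt ℝ 2 U z) (v w : Euc n) :
    fderiv ℝ (fderiv ℝ (φ ∘ U)) z v w =
      fderiv ℝ (fderiv ℝ φ) (U z) (fderiv ℝ U z v) (fderiv ℝ U z w) +
        fderiv ℝ φ (U z) (fderiv ℝ (fderiv ℝ U) z v w) := by
  have h1 : fderiv ℝ (φ ∘ U) =ᶠ[𝓝 z] fun x => (fderiv ℝ φ (U x)).comp (fderiv ℝ U x) := by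
    have e1 := hU.eventually (by simp)
    have e2 := hU.continuousAt.eventually (hφ.eventually (by simp))
    filter_upwards [e1, e2] with x hx1 hx2
    exact fderiv_comp x (hx2.differentiableAt (by simp)) (hx1.differentiableAt (by simp))
  have d1 : DifferentiableAt ℝ (fderiv ℝ φ) (U z) :=
    (hφ.fderiv_right (m := 1) (by norm_num)).differentiableAt (by simp)
  have d2 : DifferentiableAt ℝ (fderiv ℝ U) z :=
    (hU.fderiv_right (m := 1) (by norm_num)).differentiableAt (by simp)
  have d0 : DifferentiableAt ℝ U z := hU.differentiableAt (by simp)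
  have h2 : HasFDerivAt (fun x => (fderiv ℝ φ (U x)).comp (fderiv ℝ U x)) _ z :=
    (d1.hasFDerivAt.comp z d0.hasFDerivAt).clm_comp d2.hasFDerivAt
  rw [h1.fderiv_eq, h2.fderiv]
  simp [add_comm]

theorem fderiv_pullback_apply {G : E → E →L[ℝ] E →L[ℝ] ℝ} {G' : E' → E' →L[ℝ] E' →L[ℝ] ℝ}
    {φ : E → E'} {y : E} (hφ : ContDiffAt ℝ 2 φ y) (hG' : DifferentiableAt ℝ G' (φ y))
    (hG : DifferentiableAt ℝ G y)
    (h : ∀ᶠ w in 𝓝 y, ∀ a b, G w a b = G' (φ w) (fderiv ℝ φ w a) (fderiv ℝ φ w b)) (c a b : E) :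
    fderiv ℝ G y c a b = fderiv ℝ G' (φ y) (fderiv ℝ φ y c) (fderiv ℝ φ y a) (fderiv ℝ φ y b) +
      G' (φ y) (fderiv ℝ (fderiv ℝ φ) y c a) (fderiv ℝ φ y b) +
      G' (φ y) (fderiv ℝ φ y a) (fderiv ℝ (fderiv ℝ φ) y c b) := by
  have h1 : (fun w => G w a b) =ᶠ[𝓝 y] fun w => G' (φ w) (fderiv ℝ φ w a) (fderiv ℝ φ w b) := by
    filter_upwards [h] with w hw using hw a b
  have d0 : DifferentiableAt ℝ φ y := hφ.differentiableAt (by simp)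
  have d1 : DifferentiableAt ℝ (fderiv ℝ φ) y :=
    (hφ.fderiv_right (m := 1) (by norm_num)).differentiableAt (by simp)
  have e1 := (hG.hasFDerivAt.clm_apply (hasFDerivAt_const a y)).clm_apply (hasFDerivAt_const b y)
  have eG : HasFDerivAt (fun w => G' (φ w)) ((fderiv ℝ G' (φ y)).comp (fderiv ℝ φ y)) y :=
    HasFDerivAt.comp (g := G') y hG'.hasFDerivAt d0.hasFDerivAt
  have e2 := (eG.clm_apply (d1.hasFDerivAt.clm_apply (hasFDerivAt_const a y))).clm_apply
      (d1.hasFDerivAt.clm_apply (hasFDerivAt_const b y))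
  have := h1.fderiv_eq (𝕜 := ℝ)
  rw [e1.fderiv, e2.fderiv] at this
  have := congrArg (fun L : E →L[ℝ] ℝ => L c) this
  simp at this
  linarith

/-- With `P = ∂ₐU`, differentiating the pulled-back metric yields terms in `D²φ`. The two containing
`D²φ(P, c)` cancel by symmetry of `G'` and of `D²φ`. The one containing `D²φ(P, P)` is exactly what
the Hessian of `φ ∘ U` adds. Lowering the index avoids the inverse metric. -/
theorem covTension_comp {G : E → E →L[ℝ] E →L[ℝ] ℝ} {G' : E' → E' →L[ℝ] E' →L[ℝ] ℝ}
    {φ : E → E'} {U : Euc n → E} {z : Euc n} (hφ : ContDiffAt ℝ 2 φ (U z))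
    (hU : ContDiffAt ℝ 2 U z) (hG' : DifferentiableAt ℝ G' (φ (U z)))
    (hG : DifferentiableAt ℝ G (U z)) (hsymm : ∀ a b, G' (φ (U z)) a b = G' (φ (U z)) b a)
    (h : ∀ᶠ w in 𝓝 (U z), ∀ a b, G w a b = G' (φ w) (fderiv ℝ φ w a) (fderiv ℝ φ w b)) (c : E) :
    covTension G U z c = covTension G' (φ ∘ U) z (fderiv ℝ φ (U z) c) := by
  have hD : fderiv ℝ (φ ∘ U) z = (fderiv ℝ φ (U z)).comp (fderiv ℝ U z) :=
    fderiv_comp z (hφ.differentiableAt (by simp)) (hU.differentiableAt (by simp))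
  have hs : ∀ a b, fderiv ℝ (fderiv ℝ φ) (U z) a b = fderiv ℝ (fderiv ℝ φ) (U z) b a :=
    fun a b => hφ.isSymmSndFDerivAt (by simp) a b
  have ht : traceHessian (φ ∘ U) z = (∑ a, fderiv ℝ (fderiv ℝ φ) (U z)
      (fderiv ℝ U z (stdVec n a)) (fderiv ℝ U z (stdVec n a))) +
      fderiv ℝ φ (U z) (traceHessian U z) := by
    simp only [traceHessian, fderiv_fderiv_comp_apply hφ hU, Finset.sum_add_distrib, map_sum]
  rw [covTension_apply, covTension_apply, ht, h.self_of_nhds]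
  simp only [hD, ContinuousLinearMap.comp_apply, Function.comp_apply, map_add, map_sum,
    add_apply, sum_apply]
  rw [add_comm (∑ a, _) (G' _ _ _), add_assoc, ← Finset.sum_add_distrib]
  congr 1
  refine Finset.sum_congr rfl fun a _ => ?_
  rw [fderiv_pullback_apply hφ hG' hG h, fderiv_pullback_apply hφ hG' hG h,
    hs c (fderiv ℝ U z (stdVec n a)),
    hsymm (fderiv ℝ (fderiv ℝ φ) (U z) (fderiv ℝ U z (stdVec n a)) c)]
  ring

theorem covTension_congr {G : E → E →L[ℝ] E →L[ℝ] ℝ} {U V : Euc n → E} {z : Euc n}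
    (h : U =ᶠ[𝓝 z] V) : covTension G U z = covTension G V z := by
  simp only [covTension, traceHessian, h.fderiv_eq, h.fderiv.fderiv_eq, h.self_of_nhds]

end CovariantTension


/-! ### The metric in charts and its transformation law -/

section Charts

open Set Filter Topology

variable {m : ℕ} {M : Type*} [TopologicalSpace M] [ChartedSpace (Euc m) M]
  [IsManifold (𝓡 m) ∞ M]

/-- The metric read in the chart `e`, as a bilinear form depending on the coordinates. -/
def chartForm (g : RiemMetric m M) (e : OpenPartialHomeomorph M (Euc m)) (y : Euc m) :
    Euc m →L[ℝ] Euc m →L[ℝ] ℝ :=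
  let A : Euc m →L[ℝ] Euc m →L[ℝ] ℝ := g.inner (e.symm y)
  let B : Euc m →L[ℝ] Euc m := mfderiv (𝓡 m) (𝓡 m) e.symm y
  A.bilinearComp B B

theorem chartForm_apply (g : RiemMetric m M) (e : OpenPartialHomeomorph M (Euc m)) (y v w : Euc m) :
    chartForm g e y v w = g.inner (e.symm y) (mfderiv (𝓡 m) (𝓡 m) e.symm y v)
      (mfderiv (𝓡 m) (𝓡 m) e.symm y w) := rfl

theorem metricCoeff_apply (g : RiemMetric m M) (e : OpenPartialHomeomorph M (Euc m)) (y : Euc m)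
    (i j : Fin m) : metricCoeff g e y i j = chartForm g e y (stdVec m i) (stdVec m j) := rfl

variable {e e' : OpenPartialHomeomorph M (Euc m)}

theorem contMDiffOn_chart (he : e ∈ atlas (Euc m) M) : ContMDiffOn (𝓡 m) (𝓡 m) ∞ e e.source :=
  contMDiffOn_of_mem_maximalAtlas (IsManifold.subset_maximalAtlas he)

theorem contMDiffOn_chart_symm (he : e ∈ atlas (Euc m) M) :
    ContMDiffOn (𝓡 m) (𝓡 m) ∞ e.symm e.target :=
  contMDiffOn_symm_of_mem_maximalAtlas (IsManifold.subset_maximalAtlas he)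

theorem contDiffOn_chartForm_apply (g : RiemMetric m M) (he : e ∈ atlas (Euc m) M) (v w : Euc m) :
    ContDiffOn ℝ ∞ (fun y => chartForm g e y v w) e.target := by
  -- The image of a constant field under the tangent map of `e.symm` is smooth; the metric is then
  -- evaluated on two such fields.
  have hv : ∀ v : Euc m, ContMDiffOn (𝓡 m) (𝓡 m).tangent ∞
      (fun y => (⟨e.symm y, mfderiv (𝓡 m) (𝓡 m) e.symm y v⟩ : TangentBundle (𝓡 m) M)) e.target := by
    intro v
    have h1 := (contMDiffOn_chart_symm he).contMDiffOn_tangentMapWithin (m := ∞) (by simp)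
      e.open_target.uniqueMDiffOn
    have h2 : ContMDiffOn (𝓡 m) (𝓡 m).tangent ∞
        (fun y : Euc m => (⟨y, v⟩ : TangentBundle (𝓡 m) (Euc m))) e.target :=
      contMDiffOn_vectorSpace_iff_contDiffOn.2 contDiffOn_const
    refine (h1.comp h2 fun y hy => hy).congr fun y hy => ?_
    simp only [Function.comp_apply, tangentMapWithin]
    rw [mfderivWithin_of_isOpen e.open_target hy]
  intro y hy
  have hb : ContMDiffWithinAt (𝓡 m) (𝓡 m) ∞ e.symm e.target y := contMDiffOn_chart_symm he y hy
  have := ContMDiffWithinAt.clm_bundle_apply₂ (E₃ := Bundle.Trivial M ℝ) (F₃ := ℝ)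
    (g.contMDiff.contMDiffAt.comp_contMDiffWithinAt y hb) (hv v y hy) (hv w y hy)
  simp only [Bundle.contMDiffWithinAt_totalSpace] at this
  exact this.2.contDiffWithinAt

theorem contDiffOn_chartForm (g : RiemMetric m M) (he : e ∈ atlas (Euc m) M) :
    ContDiffOn ℝ ∞ (chartForm g e) e.target :=
  contDiffOn_clm_apply.2 fun v => contDiffOn_clm_apply.2 fun w => contDiffOn_chartForm_apply g he v w

theorem differentiableAt_chartForm (g : RiemMetric m M) (he : e ∈ atlas (Euc m) M) {y : Euc m}
    (hy : y ∈ e.target) : DifferentiableAt ℝ (chartForm g e) y :=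
  ((contDiffOn_chartForm g he).contDiffAt (e.open_target.mem_nhds hy)).differentiableAt (by simp)

theorem chartForm_symm (g : RiemMetric m M) (y v w : Euc m) :
    chartForm g e y v w = chartForm g e y w v := g.symm _ _ _

theorem mdifferentiableAt_chart_symm (he : e ∈ atlas (Euc m) M) {y : Euc m} (hy : y ∈ e.target) :
    MDifferentiableAt (𝓡 m) (𝓡 m) e.symm y :=
  ((contMDiffOn_chart_symm he).contMDiffAt (e.open_target.mem_nhds hy)).mdifferentiableAt (by simp)

theorem mdifferentiableAt_chart (he : e ∈ atlas (Euc m) M) {q : M} (hq : q ∈ e.source) :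
    MDifferentiableAt (𝓡 m) (𝓡 m) e q :=
  ((contMDiffOn_chart he).contMDiffAt (e.open_source.mem_nhds hq)).mdifferentiableAt (by simp)

theorem mfderiv_chart_mfderiv_chart_symm (he : e ∈ atlas (Euc m) M) {y : Euc m} (hy : y ∈ e.target)
    (v : Euc m) :
    mfderiv (𝓡 m) (𝓡 m) e (e.symm y) (mfderiv (𝓡 m) (𝓡 m) e.symm y v) = v := by
  have h := mfderiv_comp y (mdifferentiableAt_chart he (e.map_target hy))
    (mdifferentiableAt_chart_symm he hy)
  have h2 : (e ∘ e.symm) =ᶠ[𝓝 y] id := by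
    filter_upwards [e.open_target.mem_nhds hy] with w hw using e.right_inv hw
  rw [h2.mfderiv_eq, mfderiv_id] at h
  exact (congrArg (fun L => L v) h).symm

theorem mfderiv_chart_symm_mfderiv_chart (he : e ∈ atlas (Euc m) M) {q : M} (hq : q ∈ e.source)
    (v : TangentSpace (𝓡 m) q) :
    (mfderiv (𝓡 m) (𝓡 m) e.symm (e q) (mfderiv (𝓡 m) (𝓡 m) e q v) : Euc m) = v := by
  have h := mfderiv_comp q (mdifferentiableAt_chart_symm he (e.map_source hq))
    (mdifferentiableAt_chart he hq)
  have h2 : (e.symm ∘ e) =ᶠ[𝓝 q] id := by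
    filter_upwards [e.open_source.mem_nhds hq] with w hw using e.left_inv hw
  rw [h2.mfderiv_eq, mfderiv_id] at h
  exact (congrArg (fun L : Euc m →L[ℝ] Euc m => L v) h).symm

theorem chartForm_pos (g : RiemMetric m M) (he : e ∈ atlas (Euc m) M) {y : Euc m}
    (hy : y ∈ e.target) {v : Euc m} (hv : v ≠ 0) : 0 < chartForm g e y v v := by
  refine g.pos _ _ fun h => hv ?_
  exact (mfderiv_chart_mfderiv_chart_symm he hy v).symm.trans
    ((congrArg (mfderiv (𝓡 m) (𝓡 m) e (e.symm y)) h).trans (map_zero _))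

theorem contDiffAt_chart_comp_chart_symm (he : e ∈ atlas (Euc m) M) (he' : e' ∈ atlas (Euc m) M)
    {y : Euc m} (hy : y ∈ e.target) (hy' : e.symm y ∈ e'.source) :
    ContDiffAt ℝ ∞ (e' ∘ e.symm) y := by
  have h1 := (contMDiffOn_chart_symm he).contMDiffAt (e.open_target.mem_nhds hy)
  have h2 := (contMDiffOn_chart he').contMDiffAt (e'.open_source.mem_nhds hy')
  exact (h2.comp y h1).contDiffAt

/-- Chain rule for `e'.symm ∘ (e' ∘ e.symm) = e.symm` near `y`. -/
theorem chartForm_eq_pullback (g : RiemMetric m M) (he : e ∈ atlas (Euc m) M)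
    (he' : e' ∈ atlas (Euc m) M) {y : Euc m} (hy : y ∈ e.target) (hy' : e.symm y ∈ e'.source)
    (v w : Euc m) : chartForm g e y v w = chartForm g e' ((e' ∘ e.symm) y)
      (fderiv ℝ (e' ∘ e.symm) y v) (fderiv ℝ (e' ∘ e.symm) y w) := by
  have hφ := ((contDiffAt_chart_comp_chart_symm he he' hy hy').differentiableAt
    (by simp)).mdifferentiableAt
  have h := mfderiv_comp y (mdifferentiableAt_chart_symm he' (e'.map_source hy')) hφ
  have h2 : e'.symm ∘ (e' ∘ e.symm) =ᶠ[𝓝 y] e.symm := by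
    filter_upwards [e.open_target.mem_nhds hy, (e.continuousAt_symm hy).preimage_mem_nhds
      (e'.open_source.mem_nhds hy')] with w hw hw' using e'.left_inv hw'
  rw [h2.mfderiv_eq] at h
  have hv : ∀ v, mfderiv (𝓡 m) (𝓡 m) e'.symm ((e' ∘ e.symm) y) (fderiv ℝ (e' ∘ e.symm) y v) =
      (mfderiv (𝓡 m) (𝓡 m) e.symm y v : Euc m) := fun v => by
    rw [← mfderiv_eq_fderiv]
    exact (congrArg (fun L : Euc m →L[ℝ] Euc m => L v) h).symm
  have hpt : e'.symm ((e' ∘ e.symm) y) = e.symm y := e'.left_inv hy'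
  -- The base points agree only propositionally, so the inner product is transported along their
  -- equality, all tangent spaces being `Euc m`.
  have key : ∀ (q q' : M) (_ : q = q') (a b : Euc m),
      g.inner q (a : TangentSpace (𝓡 m) q) (b : TangentSpace (𝓡 m) q) =
      g.inner q' (a : TangentSpace (𝓡 m) q') (b : TangentSpace (𝓡 m) q') := by
    rintro q _ rfl a b; rfl
  rw [chartForm_apply, chartForm_apply]
  refine (key _ _ hpt.symm _ _).trans ?_
  rw [← hv v, ← hv w]

end Charts


/-! ### The coordinate tension and its chart independence -/

section Tension

open Set Filter Topology

theorem sum_apply_smul_stdVec {n : ℕ} (v : Euc n) : ∑ i, v i • stdVec n i = v := by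
  ext j
  simp [stdVec, Finset.sum_apply, Pi.single_apply]

theorem partialDeriv_coord {n m : ℕ} {U : Euc n → Euc m} {z : Euc n} (hU : DifferentiableAt ℝ U z)
    (a : Fin n) (i : Fin m) :
    partialDeriv a (fun w => U w i) z = (fderiv ℝ U z (stdVec n a)) i := by
  have h := ((EuclideanSpace.proj i : Euc m →L[ℝ] ℝ).hasFDerivAt.comp z hU.hasFDerivAt)
  have h' : HasFDerivAt (fun w => U w i) ((EuclideanSpace.proj i : Euc m →L[ℝ] ℝ).comp
    (fderiv ℝ U z)) z := h
  rw [partialDeriv, h'.fderiv]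
  rfl

theorem traceHessian_eq_laplacian {n : ℕ} {E : Type*} [NormedAddCommGroup E] [NormedSpace ℝ E]
    (U : Euc n → E) (z : Euc n) : traceHessian U z = Laplacian.laplacian U z := by
  rw [InnerProductSpace.laplacian_eq_iteratedFDeriv_orthonormalBasis U
    (EuclideanSpace.basisFun (Fin n) ℝ)]
  simp [traceHessian, iteratedFDeriv_two_apply, stdVec]

theorem laplacian_coord {n m : ℕ} {U : Euc n → Euc m} {z : Euc n} (hU : ContDiffAt ℝ 2 U z)
    (k : Fin m) :
    (Laplacian.laplacian (fun w : Euc n => U w k) : Euc n → ℝ) z = traceHessian U z k := by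
  rw [traceHessian_eq_laplacian]
  exact hU.laplacian_CLM_comp_left (l := (EuclideanSpace.proj k : Euc m →L[ℝ] ℝ))

variable {m : ℕ} {M : Type*} [TopologicalSpace M] [ChartedSpace (Euc m) M]
  [IsManifold (𝓡 m) ∞ M] {e e' : OpenPartialHomeomorph M (Euc m)} (g : RiemMetric m M)

theorem partialDeriv_metricCoeff (he : e ∈ atlas (Euc m) M) {y : Euc m} (hy : y ∈ e.target)
    (i j l : Fin m) : partialDeriv i (fun w => metricCoeff g e w j l) y =
      fderiv ℝ (chartForm g e) y (stdVec m i) (stdVec m j) (stdVec m l) := by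
  have h := ((differentiableAt_chartForm g he hy).hasFDerivAt.clm_apply
    (hasFDerivAt_const (stdVec m j) y)).clm_apply (hasFDerivAt_const (stdVec m l) y)
  have h' := h.fderiv
  simp only [metricCoeff_apply, partialDeriv]
  rw [h']
  simp

theorem chartForm_eq_sum (y v w : Euc m) :
    chartForm g e y v w = ∑ i, ∑ j, v i * w j * metricCoeff g e y i j := by
  conv_lhs => rw [← sum_apply_smul_stdVec v, ← sum_apply_smul_stdVec w]
  simp only [map_sum, map_smul, sum_apply, smul_apply, smul_eq_mul, metricCoeff_apply,
    Finset.mul_sum]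
  rw [Finset.sum_comm]
  simp only [mul_assoc, mul_left_comm]

theorem isUnit_metricCoeff (he : e ∈ atlas (Euc m) M) {y : Euc m} (hy : y ∈ e.target) :
    IsUnit (metricCoeff g e y) := by
  rw [← Matrix.mulVec_injective_iff_isUnit]
  refine (injective_iff_map_eq_zero' (Matrix.mulVecLin (metricCoeff g e y))).2 fun v => ?_
  refine ⟨fun h => ?_, fun h => by simp [h]⟩
  by_contra hv
  have h1 := chartForm_pos g he hy (v := WithLp.toLp 2 v) (by simpa using hv)
  rw [chartForm_eq_sum] at h1
  have h2 : ∀ i, ∑ j, metricCoeff g e y i j * v j = 0 := fun i => congrFun h i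
  have h3 : ∑ i, ∑ j, v i * v j * metricCoeff g e y i j = 0 := by
    refine Finset.sum_eq_zero fun i _ => ?_
    calc ∑ j, v i * v j * metricCoeff g e y i j = v i * ∑ j, metricCoeff g e y i j * v j := by
          rw [Finset.mul_sum]; exact Finset.sum_congr rfl fun j _ => by ring
      _ = 0 := by rw [h2, mul_zero]
  exact h1.ne' h3

theorem sum_metricCoeff_mul_christoffel (he : e ∈ atlas (Euc m) M) {y : Euc m} (hy : y ∈ e.target)
    (c i j : Fin m) : ∑ k, metricCoeff g e y c k * christoffel g e k i j y =
      (1 / 2 : ℝ) * (partialDeriv i (fun w => metricCoeff g e w j c) y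
      + partialDeriv j (fun w => metricCoeff g e w i c) y
      - partialDeriv c (fun w => metricCoeff g e w i j) y) := by
  have hinv : metricCoeff g e y * (metricCoeff g e y)⁻¹ = 1 :=
    Matrix.mul_nonsing_inv _ ((Matrix.isUnit_iff_isUnit_det _).1 (isUnit_metricCoeff g he hy))
  set S : Fin m → ℝ := fun l => partialDeriv i (fun w => metricCoeff g e w j l) y
      + partialDeriv j (fun w => metricCoeff g e w i l) y
      - partialDeriv l (fun w => metricCoeff g e w i j) y with hS
  have h1 : ∀ k, christoffel g e k i j y = (1 / 2 : ℝ) * ((metricCoeff g e y)⁻¹.mulVec S) k :=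
    fun k => rfl
  have h2 : (metricCoeff g e y).mulVec ((metricCoeff g e y)⁻¹.mulVec S) = S := by
    rw [Matrix.mulVec_mulVec, hinv, Matrix.one_mulVec]
  have h3 : ∑ k, metricCoeff g e y c k * ((metricCoeff g e y)⁻¹.mulVec S) k = S c := congrFun h2 c
  simp only [h1, mul_left_comm _ (1 / 2 : ℝ), ← Finset.mul_sum, h3]
  rfl

/-- Multiplication by `g_{ck}` cancels the inverse metric in the Christoffel symbols. The first two
of the three remaining terms agree after contraction with the symmetric `Pⁱ Pʲ`, which turns `½ + ½`
into the coefficient `1` of `covTension`. -/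
theorem sum_metricCoeff_mul_tension {n : ℕ} (he : e ∈ atlas (Euc m) M) {u : Euc n → M} {z : Euc n}
    (hu : ContDiffAt ℝ 2 (e ∘ u) z) (hz : u z ∈ e.source) (c : Fin m) :
    ∑ k, metricCoeff g e (e (u z)) c k * tension g e u k z =
      covTension (chartForm g e) (e ∘ u) z (stdVec m c) := by
  have hy : e (u z) ∈ e.target := e.map_source hz
  have hd : DifferentiableAt ℝ (e ∘ u) z := hu.differentiableAt (by simp)
  have hl : ∀ k, (Laplacian.laplacian (fun w : Euc n => e (u w) k) : Euc n → ℝ) z =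
      traceHessian (e ∘ u) z k := fun k => laplacian_coord hu k
  have hp : ∀ a i, partialDeriv a (fun w => e (u w) i) z = (fderiv ℝ (e ∘ u) z (stdVec n a)) i :=
    fun a i => partialDeriv_coord hd a i
  set P : Fin n → Euc m := fun a => fderiv ℝ (e ∘ u) z (stdVec n a) with hP
  set D : Fin m → Fin m → Fin m → ℝ := fun i j l =>
    fderiv ℝ (chartForm g e) (e (u z)) (stdVec m i) (stdVec m j) (stdVec m l) with hD
  have hDsymm : ∀ i j l, D i j l = D i l j := by
    intro i j l
    simp only [hD]
    rw [← partialDeriv_metricCoeff g he hy, ← partialDeriv_metricCoeff g he hy]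
    congr 2
    ext w
    exact chartForm_symm g _ _ _
  have hD1 : ∀ v w : Euc m, fderiv ℝ (chartForm g e) (e (u z)) v w (stdVec m c) =
      ∑ i, ∑ j, D i j c * v i * w j := by
    intro v w
    conv_lhs => rw [← sum_apply_smul_stdVec v, ← sum_apply_smul_stdVec w]
    simp only [map_sum, map_smul, sum_apply, smul_apply, smul_eq_mul, Finset.mul_sum]
    rw [Finset.sum_comm]
    exact Finset.sum_congr rfl fun i _ => Finset.sum_congr rfl fun j _ => by simp only [hD]; ring
  have hD2 : ∀ v w : Euc m, fderiv ℝ (chartForm g e) (e (u z)) (stdVec m c) v w =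
      ∑ i, ∑ j, D c i j * v i * w j := by
    intro v w
    conv_lhs => rw [← sum_apply_smul_stdVec v, ← sum_apply_smul_stdVec w]
    simp only [map_sum, map_smul, sum_apply, smul_apply, smul_eq_mul, Finset.mul_sum]
    rw [Finset.sum_comm]
    exact Finset.sum_congr rfl fun i _ => Finset.sum_congr rfl fun j _ => by simp only [hD]; ring
  have hG : chartForm g e (e (u z)) (traceHessian (e ∘ u) z) (stdVec m c) =
      ∑ k, metricCoeff g e (e (u z)) c k * traceHessian (e ∘ u) z k := by
    conv_lhs => rw [← sum_apply_smul_stdVec (traceHessian (e ∘ u) z), chartForm_symm]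
    simp only [map_sum, map_smul, smul_eq_mul, metricCoeff_apply]
    exact Finset.sum_congr rfl fun i _ => by ring
  rw [covTension_apply]
  simp only [tension, hl, hp, mul_add, Finset.sum_add_distrib, Function.comp_apply]
  rw [hG]
  congr 1
  simp only [Finset.mul_sum]
  rw [Finset.sum_comm]
  refine Finset.sum_congr rfl fun a _ => ?_
  have hswap : ∑ k, ∑ i, ∑ j, metricCoeff g e (e (u z)) c k *
      (christoffel g e k i j (e (u z)) * P a i * P a j) =
      ∑ i, ∑ j, (1 / 2 : ℝ) * (D i j c + D j i c - D c i j) * P a i * P a j := by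
    rw [Finset.sum_comm]
    refine Finset.sum_congr rfl fun i _ => ?_
    rw [Finset.sum_comm]
    refine Finset.sum_congr rfl fun j _ => ?_
    have h := sum_metricCoeff_mul_christoffel g he hy c i j
    rw [partialDeriv_metricCoeff g he hy, partialDeriv_metricCoeff g he hy,
      partialDeriv_metricCoeff g he hy] at h
    simp only [hD]
    rw [← h, Finset.sum_mul, Finset.sum_mul]
    exact Finset.sum_congr rfl fun k _ => by ring
  rw [hswap]
  change _ = fderiv ℝ (chartForm g e) (e (u z)) (P a) (P a) (stdVec m c) -
    (1 / 2 : ℝ) * fderiv ℝ (chartForm g e) (e (u z)) (stdVec m c) (P a) (P a)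
  rw [hD1, hD2]
  have hcomm : ∑ i, ∑ j, D j i c * P a i * P a j = ∑ i, ∑ j, D i j c * P a i * P a j := by
    rw [Finset.sum_comm]
    exact Finset.sum_congr rfl fun i _ => Finset.sum_congr rfl fun j _ => by ring
  have hsplit : ∑ i, ∑ j, (1 / 2 : ℝ) * (D i j c + D j i c - D c i j) * P a i * P a j =
      (1 / 2 : ℝ) * ∑ i, ∑ j, D i j c * P a i * P a j +
      (1 / 2 : ℝ) * ∑ i, ∑ j, D j i c * P a i * P a j -
      (1 / 2 : ℝ) * ∑ i, ∑ j, D c i j * P a i * P a j := by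
    simp only [Finset.mul_sum, ← Finset.sum_add_distrib, ← Finset.sum_sub_distrib]
    exact Finset.sum_congr rfl fun i _ => Finset.sum_congr rfl fun j _ => by ring
  rw [hsplit, hcomm]
  ring

/-- Lowering the index loses nothing, since the metric matrix is invertible. -/
theorem forall_tension_eq_zero_iff {n : ℕ} (he : e ∈ atlas (Euc m) M) {u : Euc n → M} {z : Euc n}
    (hu : ContDiffAt ℝ 2 (e ∘ u) z) (hz : u z ∈ e.source) :
    (∀ k, tension g e u k z = 0) ↔ covTension (chartForm g e) (e ∘ u) z = 0 := by
  have h := sum_metricCoeff_mul_tension g he hu hz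
  constructor
  · intro h0
    ext v
    rw [← sum_apply_smul_stdVec v, map_sum]
    refine Finset.sum_eq_zero fun c _ => ?_
    rw [map_smul, ← h c]
    simp [h0]
  · intro h0
    have hinj := Matrix.mulVec_injective_iff_isUnit.2 (isUnit_metricCoeff g he (e.map_source hz))
    have : (fun k => tension g e u k z) = 0 := by
      refine hinj ?_
      rw [Matrix.mulVec_zero]
      ext c
      rw [Pi.zero_apply]
      refine (h c).trans ?_
      rw [h0]
      rfl
    exact fun k => congrFun this k

theorem contDiffAt_chart_comp {n : ℕ} (he : e ∈ atlas (Euc m) M) {u : Euc n → M} {z : Euc n}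
    (hu : ContMDiffAt (𝓡 n) (𝓡 m) 2 u z) (hz : u z ∈ e.source) : ContDiffAt ℝ 2 (e ∘ u) z :=
  (((contMDiffOn_chart he).contMDiffAt (e.open_source.mem_nhds hz)).of_le (by norm_cast)
    |>.comp z hu).contDiffAt

/-- If the tension field of `u` at `z` vanishes in one chart, then it vanishes in all charts. -/
theorem tension_eq_zero_of_tension_eq_zero {n : ℕ} (he : e ∈ atlas (Euc m) M)
    (he' : e' ∈ atlas (Euc m) M) {u : Euc n → M} {z : Euc n}
    (hu : ContMDiffAt (𝓡 n) (𝓡 m) 2 u z) (hz : u z ∈ e.source) (hz' : u z ∈ e'.source)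
    (h : ∀ k, tension g e' u k z = 0) (k : Fin m) : tension g e u k z = 0 := by
  have hU := contDiffAt_chart_comp he hu hz
  have hU' := contDiffAt_chart_comp he' hu hz'
  refine (forall_tension_eq_zero_iff g he hU hz).2 ?_ k
  have h0 := (forall_tension_eq_zero_iff g he' hU' hz').1 h
  have hy : (e ∘ u) z ∈ e.target := e.map_source hz
  have hy' : e.symm ((e ∘ u) z) = u z := e.left_inv hz
  have hy2 : e.symm ((e ∘ u) z) ∈ e'.source := hy'.symm ▸ hz'
  have hφz : (e' ∘ e.symm) ((e ∘ u) z) = e' (u z) := congrArg e' hy'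
  have heq : (e' ∘ e.symm) ∘ (e ∘ u) =ᶠ[𝓝 z] e' ∘ u := by
    filter_upwards [hu.continuousAt.preimage_mem_nhds (e.open_source.mem_nhds hz)] with w hw
    exact congrArg e' (e.left_inv hw)
  ext c
  rw [covTension_comp (φ := e' ∘ e.symm) (G' := chartForm g e')
    ((contDiffAt_chart_comp_chart_symm he he' hy hy2).of_le (by norm_cast)) hU
    (differentiableAt_chartForm g he' (by rw [hφz]; exact e'.map_source hz'))
    (differentiableAt_chartForm g he hy) (fun a b => chartForm_symm g _ a b) ?_ c,
    covTension_congr heq, h0]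
  · rfl
  · filter_upwards [e.open_target.mem_nhds hy, (e.continuousAt_symm hy).preimage_mem_nhds
      (e'.open_source.mem_nhds hy2)] with w hw hw' a b
    exact chartForm_eq_pullback g he he' hw hw' a b

theorem contDiffOn_metricCoeff (he : e ∈ atlas (Euc m) M) (i j : Fin m) :
    ContDiffOn ℝ ∞ (fun y => metricCoeff g e y i j) e.target :=
  contDiffOn_chartForm_apply g he _ _

theorem contDiffOn_partialDeriv {f : Euc m → ℝ} {s : Set (Euc m)} (hs : IsOpen s)
    (hf : ContDiffOn ℝ ∞ f s) (i : Fin m) : ContDiffOn ℝ ∞ (partialDeriv i f) s :=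
  (hf.fderiv_of_isOpen hs (m := ∞) (by simp)).clm_apply contDiffOn_const

theorem contDiffOn_det {s : Set (Euc m)} {A : Euc m → Matrix (Fin m) (Fin m) ℝ}
    (hA : ∀ i j, ContDiffOn ℝ ∞ (fun y => A y i j) s) : ContDiffOn ℝ ∞ (fun y => (A y).det) s := by
  simp only [Matrix.det_apply]
  refine ContDiffOn.sum fun σ _ => ContDiffOn.const_smul _ ?_
  exact contDiffOn_prod fun i _ => hA _ _

theorem contDiffOn_matrix_inv {s : Set (Euc m)} {A : Euc m → Matrix (Fin m) (Fin m) ℝ}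
    (hA : ∀ i j, ContDiffOn ℝ ∞ (fun y => A y i j) s) (hu : ∀ y ∈ s, IsUnit (A y)) (i j : Fin m) :
    ContDiffOn ℝ ∞ (fun y => (A y)⁻¹ i j) s := by
  -- Cramer's rule: an entry of the inverse is a quotient of determinants, which are polynomial in
  -- the entries.
  have h : ∀ y, (A y)⁻¹ i j = (A y).det⁻¹ * ((A y).updateRow j (Pi.single i 1)).det := fun y => by
    rw [Matrix.inv_def, Matrix.smul_apply, Ring.inverse_eq_inv', Matrix.adjugate_apply, smul_eq_mul]
  simp only [h]
  refine ((contDiffOn_det hA).inv fun y hy => ?_).mul (contDiffOn_det fun a b => ?_)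
  · exact ((Matrix.isUnit_iff_isUnit_det _).1 (hu y hy)).ne_zero
  · by_cases hab : a = j
    · subst hab
      simpa using contDiffOn_const
    · simpa [Matrix.updateRow_ne hab] using hA a b

theorem contDiffOn_christoffel (he : e ∈ atlas (Euc m) M) (k i j : Fin m) :
    ContDiffOn ℝ ∞ (christoffel g e k i j) e.target := by
  have hp : ∀ i j l, ContDiffOn ℝ ∞ (partialDeriv i fun w => metricCoeff g e w j l) e.target :=
    fun i j l => contDiffOn_partialDeriv e.open_target (contDiffOn_metricCoeff g he j l) i
  refine contDiffOn_const.mul (ContDiffOn.sum fun l _ => ?_)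
  exact (contDiffOn_matrix_inv (contDiffOn_metricCoeff g he)
    (fun y hy => isUnit_metricCoeff g he hy) k l).mul (((hp i j l).add (hp j i l)).sub (hp l i j))

end Tension


/-! ### Local solutions of quadratic gradient systems -/

section LocalExistence

open Set Filter Topology

variable {F : Type*} [NormedAddCommGroup F] [NormedSpace ℝ F]

/-- A compactly supported `C²` function of two variables: its slices and their derivatives are
uniformly bounded, and the latter are uniformly Lipschitz. -/
theorem exists_bound_slices {S : Type*} [NormedAddCommGroup S] [NormedSpace ℝ S] {K : ℝ × S → F}
    (hK : ContDiff ℝ 2 K) (hc : HasCompactSupport K) :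
    ∃ C, 0 ≤ C ∧ ∀ ε, (∀ j, ‖K (ε, j)‖ ≤ C) ∧ (∀ j, ‖fderiv ℝ (fun j => K (ε, j)) j‖ ≤ C) ∧
      ∀ j j', ‖fderiv ℝ (fun j => K (ε, j)) j - fderiv ℝ (fun j => K (ε, j)) j'‖ ≤
        C * ‖j - j'‖ := by
  have h1 : ContDiff ℝ 1 (fderiv ℝ K) := hK.fderiv_right (by norm_num)
  obtain ⟨C0, hC0⟩ := hK.continuous.bounded_above_of_compact_support hc
  obtain ⟨C1, hC1⟩ := h1.continuous.bounded_above_of_compact_support (hc.fderiv ℝ)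
  obtain ⟨C2, hC2⟩ := (h1.continuous_fderiv one_ne_zero).bounded_above_of_compact_support
    ((hc.fderiv ℝ).fderiv ℝ)
  have hd : ∀ ε : ℝ, ∀ j : S, fderiv ℝ (fun j => K (ε, j)) j =
      (fderiv ℝ K (ε, j)).comp (ContinuousLinearMap.inr ℝ ℝ S) := fun ε j =>
    ((hK.differentiable (by simp) _).hasFDerivAt.comp j (hasFDerivAt_prodMk_right ε j)).fderiv
  have hcomp : ∀ L : (ℝ × S) →L[ℝ] F, ‖L.comp (ContinuousLinearMap.inr ℝ ℝ S)‖ ≤ ‖L‖ := fun L =>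
    (ContinuousLinearMap.opNorm_comp_le _ _).trans
      (mul_le_of_le_one_right (norm_nonneg _) (ContinuousLinearMap.norm_inr_le_one ℝ ℝ S))
  refine ⟨max C0 (max C1 C2), le_max_of_le_left ((norm_nonneg _).trans (hC0 0)),
    fun ε => ⟨fun j => (hC0 _).trans (le_max_left _ _), fun j => ?_, fun j j' => ?_⟩⟩
  · rw [hd]
    exact (hcomp _).trans ((hC1 _).trans ((le_max_left _ _).trans (le_max_right _ _)))
  · rw [hd, hd, ← ContinuousLinearMap.sub_comp]
    refine (hcomp _).trans ?_
    have h := convex_univ.norm_image_sub_le_of_norm_fderiv_le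
      (fun x _ => h1.differentiable one_ne_zero x) (fun x _ => hC2 x)
      (mem_univ (ε, j')) (mem_univ (ε, j))
    have hsub : ‖((ε, j) : ℝ × S) - (ε, j')‖ = ‖j - j'‖ := by
      rw [Prod.mk_sub_mk, sub_self, Prod.norm_mk, norm_zero]
      exact max_eq_right (norm_nonneg _)
    rw [hsub] at h
    exact h.trans (mul_le_mul_of_nonneg_right ((le_max_right _ _).trans (le_max_right _ _))
      (norm_nonneg _))

/-- The parameter `ε` is one of the variables in which `K` has compact support. This makes `C`
independent of `ε`, as is required because the admissible size of `ε` is chosen after `C`. -/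
theorem exists_isTame {K : ℝ × Euc 2 × F × (Euc 2 →L[ℝ] F) → F}
    (hK : ContDiff ℝ 2 K) (hc : HasCompactSupport K) {R : ℝ} (hR : ∀ x, R < ‖x‖ → K x = 0) :
    ∃ C, 0 ≤ C ∧ ∀ ε, IsTame (fun j => K (ε, j)) R C := by
  obtain ⟨C, hC0, hC⟩ := exists_bound_slices hK hc
  refine ⟨C, hC0, fun ε => ⟨?_, (hC ε).1, (hC ε).2.1, (hC ε).2.2, fun j hj => ?_⟩⟩
  · exact (hK.of_le (by norm_num)).comp (contDiff_const.prodMk contDiff_id)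
  · exact hR (ε, j) (hj.trans_le ((norm_fst_le j).trans (norm_snd_le (ε, j))))

theorem norm_le_of_norm_fderiv_sub_le {w : Euc 2 → F} {l : Euc 2 →L[ℝ] F} (hw : Differentiable ℝ w)
    (h0 : w 0 = 0) (h : ∀ x, ‖fderiv ℝ w x - l‖ ≤ 1) (x : Euc 2) :
    ‖fderiv ℝ w x‖ ≤ ‖l‖ + 1 ∧ ‖w x‖ ≤ (‖l‖ + 1) * ‖x‖ := by
  have h1 : ∀ x, ‖fderiv ℝ w x‖ ≤ ‖l‖ + 1 := fun x => by
    have := norm_le_norm_add_norm_sub' (fderiv ℝ w x) l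
    linarith [h x]
  refine ⟨h1 x, ?_⟩
  have := convex_univ.norm_image_sub_le_of_norm_fderiv_le (fun x _ => hw x) (fun x _ => h1 x)
    (mem_univ 0) (mem_univ x)
  simpa [h0] using this

/-- A smooth function on an open set, multiplied by a bump function supported in that set. -/
theorem contDiff_bump_smul {E : Type*} [NormedAddCommGroup E] [NormedSpace ℝ E]
    {G : Type*} [NormedAddCommGroup G] [NormedSpace ℝ G]
    {s : Set E} (hs : IsOpen s) {ρ : E → ℝ} (hρ : ContDiff ℝ ∞ ρ) (hsupp : tsupport ρ ⊆ s)
    {f : E → G} (hf : ContDiffOn ℝ ∞ f s) : ContDiff ℝ ∞ fun y => ρ y • f y := by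
  rw [contDiff_iff_contDiffAt]
  intro y
  by_cases hy : y ∈ s
  · exact hρ.contDiffAt.smul (hf.contDiffAt (hs.mem_nhds hy))
  · have : (fun y => ρ y • f y) =ᶠ[𝓝 y] fun _ => 0 := by
      have hy' : y ∉ tsupport ρ := fun h => hy (hsupp h)
      filter_upwards [notMem_tsupport_iff_eventuallyEq.1 hy'] with w hw
      simp [hw]
    exact contDiffAt_const.congr_of_eventuallyEq this

/-- Local solvability of `Δ U = Q(U, DU)` in the plane, where `Q` is smooth, and quadratic in the
second variable. -/
theorem exists_solution_quadratic [FiniteDimensional ℝ F] {s : Set F} (hs : IsOpen s) {y₀ : F} (hy₀ : y₀ ∈ s)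
    {Q : F × (Euc 2 →L[ℝ] F) → F} (hQ : ContDiffOn ℝ ∞ Q (s ×ˢ univ))
    (hhom : ∀ (y : F) (A : Euc 2 →L[ℝ] F) (t : ℝ), Q (y, t • A) = t ^ 2 • Q (y, A))
    (l : Euc 2 →L[ℝ] F) :
    ∃ ε > (0 : ℝ), ∃ U : Euc 2 → F, ContDiff ℝ 2 U ∧ U 0 = y₀ ∧ fderiv ℝ U 0 = ε • l ∧
      ∀ z ∈ Metric.ball (0 : Euc 2) 1, U z ∈ s ∧ traceHessian U z = Q (U z, fderiv ℝ U z) := by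
  obtain ⟨d, hd0, hd⟩ := Metric.isOpen_iff.1 hs y₀ hy₀
  let ρ : ContDiffBump y₀ := ⟨d / 4, d / 2, by positivity, by linarith⟩
  have hρs : tsupport ρ ⊆ s := by
    rw [ρ.tsupport_eq]
    exact (Metric.closedBall_subset_ball (by show d / 2 < d; linarith)).trans hd
  -- On the unit disk, solutions satisfy `‖w‖, ‖Dw‖ ≤ ‖l‖ + 1`, and `ε` and `‖z‖` are at most `1`.
  -- The cutoff `β` is therefore `1` on every jet that occurs there.
  let r : ℝ := ‖l‖ + 2
  have hr : 0 < r := by positivity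
  let β : ContDiffBump (0 : ℝ × Euc 2 × F × (Euc 2 →L[ℝ] F)) := ⟨r, r + 1, hr, by linarith⟩
  have hQ' : ContDiff ℝ ∞ fun x : F × (Euc 2 →L[ℝ] F) => ρ x.1 • Q x := by
    refine contDiff_bump_smul (hs.prod isOpen_univ) (ρ := fun x => ρ x.1) ?_ ?_ hQ
    · exact ρ.contDiff.comp (contDiff_fst (𝕜 := ℝ) (E := F) (F := Euc 2 →L[ℝ] F))
    intro x hx
    exact ⟨hρs ((tsupport_comp_subset_preimage _ continuous_fst) hx), mem_univ _⟩
  -- For `U = y₀ + ε w`, homogeneity gives `Q(U, DU) = ε² Q(y₀ + ε w, Dw)`, so the equation for `w`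
  -- is `Δw = ε Q(y₀ + ε w, Dw)`. The two cutoffs make its right-hand side globally defined with
  -- compact support.
  let K : ℝ × Euc 2 × F × (Euc 2 →L[ℝ] F) → F := fun x =>
    β x • (ρ (y₀ + x.1 • x.2.2.1) • Q (y₀ + x.1 • x.2.2.1, x.2.2.2))
  have hK : ContDiff ℝ ∞ K := by
    refine β.contDiff.smul ?_
    have : ContDiff ℝ ∞ fun x : ℝ × Euc 2 × F × (Euc 2 →L[ℝ] F) =>
        (y₀ + x.1 • x.2.2.1, x.2.2.2) := by fun_prop
    exact hQ'.comp this
  have hKc : HasCompactSupport K := β.hasCompactSupport.smul_right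
  have hK0 : ∀ x, r + 1 < ‖x‖ → K x = 0 := fun x hx => by
    have : β x = 0 := β.zero_of_le_dist (by rw [dist_zero_right]; exact hx.le)
    simp only [K, this, zero_smul]
  obtain ⟨C, hC0, hC⟩ := exists_isTame (hK.of_le (by norm_cast)) hKc hK0
  obtain ⟨ε₀, hε₀, hsol⟩ := exists_solution_semilinear l (R := r + 1) (by positivity) hC0
  -- The last bound gives `ε * ‖w‖ ≤ d / 4` on the unit disk, which keeps `U` where `ρ = 1`.
  let ε : ℝ := min (min ε₀ 1) (d / (4 * r))
  have hε : 0 < ε := lt_min (lt_min hε₀ one_pos) (by positivity)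
  have hε1 : ε ≤ 1 := (min_le_left _ _).trans (min_le_right _ _)
  have hεr : ε * r ≤ d / 4 := by
    have : ε ≤ d / (4 * r) := min_le_right _ _
    rw [le_div_iff₀ (by positivity)] at this
    linarith
  obtain ⟨w, hw, hw0, hwl, hwb, hweq⟩ := hsol ε
    (by rw [abs_of_pos hε]; exact (min_le_left _ _).trans (min_le_left _ _)) _ (hC ε)
  have hwd : Differentiable ℝ w := hw.differentiable (by simp)
  have hfd : fderiv ℝ (fun z => y₀ + ε • w z) = fun z => ε • fderiv ℝ w z := by
    ext1 z
    exact (((hwd z).hasFDerivAt.const_smul ε).const_add y₀).fderiv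
  refine ⟨ε, hε, fun z => y₀ + ε • w z, contDiff_const.add (hw.const_smul ε), ?_, ?_, ?_⟩
  · simp [hw0]
  · simp only [hfd, hwl]
  · intro z hz
    rw [mem_ball_zero_iff] at hz
    obtain ⟨hb1, hb2⟩ := norm_le_of_norm_fderiv_sub_le hwd hw0 hwb z
    have hwr : ‖w z‖ ≤ r := by
      refine hb2.trans ?_
      show (‖l‖ + 1) * ‖z‖ ≤ ‖l‖ + 2
      nlinarith [norm_nonneg l, norm_nonneg z]
    have hin : y₀ + ε • w z ∈ Metric.closedBall y₀ (d / 4) := by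
      rw [Metric.mem_closedBall, dist_eq_norm, add_sub_cancel_left, norm_smul,
        Real.norm_of_nonneg hε.le]
      exact (mul_le_mul_of_nonneg_left hwr hε.le).trans hεr
    have hr2 : (2 : ℝ) ≤ r := by show 2 ≤ ‖l‖ + 2; linarith [norm_nonneg l]
    have hβ : β (ε, z, w z, fderiv ℝ w z) = 1 := by
      refine β.one_of_mem_closedBall ?_
      rw [mem_closedBall_zero_iff]
      show ‖(ε, z, w z, fderiv ℝ w z)‖ ≤ r
      simp only [Prod.norm_mk]
      refine max_le ?_ (max_le (by linarith) (max_le hwr (hb1.trans ?_)))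
      · rw [Real.norm_of_nonneg hε.le]; linarith
      · show ‖l‖ + 1 ≤ ‖l‖ + 2
        linarith
    have hρ : ρ (y₀ + ε • w z) = 1 := ρ.one_of_mem_closedBall hin
    refine ⟨hd (Metric.closedBall_subset_ball (by linarith) hin), ?_⟩
    have hD2 : fderiv ℝ (fun z => ε • fderiv ℝ w z) z = ε • fderiv ℝ (fderiv ℝ w) z :=
      (((hw.fderiv_right (m := 1) (by norm_num)).differentiable one_ne_zero z).hasFDerivAt.const_smul
        ε).fderiv
    simp only [traceHessian, hfd, hD2, hhom]
    simp only [smul_apply, ← Finset.smul_sum]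
    rw [hweq z]
    simp only [K, hβ, hρ, smul_smul, mul_one]
    rw [sq]

end LocalExistence


/-! ### Rescaling of admissible disks -/

section Scaling

open Set Filter Topology

variable {m : ℕ} {M : Type*} [TopologicalSpace M] [ChartedSpace (Euc m) M]
  [IsManifold (𝓡 m) ∞ M] {e : OpenPartialHomeomorph M (Euc m)} (g : RiemMetric m M)

omit [IsManifold (𝓡 m) ∞ M] in
theorem tangentBundle_mk_eq_iff {p q : M} (v : TangentSpace (𝓡 m) q) (X : TangentSpace (𝓡 m) p) :
    (⟨q, v⟩ : TangentBundle (𝓡 m) M) = ⟨p, X⟩ ↔ q = p ∧ (v : Euc m) = (X : Euc m) := by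
  constructor
  · intro h
    cases h
    exact ⟨rfl, rfl⟩
  · rintro ⟨rfl, h⟩
    exact congrArg (fun w : TangentSpace (𝓡 m) q => (⟨q, w⟩ : TangentBundle (𝓡 m) M)) h

theorem inner_congr {p q : M} (h : p = q) (v w : Euc m) :
    g.inner p (v : TangentSpace (𝓡 m) p) (w : TangentSpace (𝓡 m) p) =
      g.inner q (v : TangentSpace (𝓡 m) q) (w : TangentSpace (𝓡 m) q) := by
  subst h; rfl

/-- Second derivatives and products of two first derivatives both scale by `c ^ 2`. -/
theorem tension_comp_smul {n : ℕ} {u : Euc n → M} {z : Euc n} {c : ℝ}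
    (hu : ContDiffAt ℝ 2 (e ∘ u) (c • z)) (k : Fin m) :
    tension g e (fun w => u (c • w)) k z = c ^ 2 * tension g e u k (c • z) := by
  let ψ : Euc n →L[ℝ] Euc n := c • ContinuousLinearMap.id ℝ (Euc n)
  have hψ : ContDiffAt ℝ 2 ψ z := ψ.contDiff.contDiffAt
  have hu' : ContDiffAt ℝ 2 (e ∘ u) (ψ z) := hu
  have hcomp : ContDiffAt ℝ 2 ((e ∘ u) ∘ ψ) z := hu'.comp z hψ
  have hψ1 : fderiv ℝ ψ = fun _ => ψ := funext fun x => ψ.fderiv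
  have hψ2 : fderiv ℝ (fderiv ℝ ψ) z = 0 := by rw [hψ1]; exact fderiv_const_apply _
  have hD : ∀ v, fderiv ℝ ((e ∘ u) ∘ ψ) z v = c • fderiv ℝ (e ∘ u) (c • z) v := fun v => by
    rw [fderiv_comp z (hu'.differentiableAt (by simp)) (hψ.differentiableAt (by simp)), hψ1]
    simp [ψ]
  have hH : traceHessian ((e ∘ u) ∘ ψ) z = c ^ 2 • traceHessian (e ∘ u) (c • z) := by
    simp only [traceHessian, fderiv_fderiv_comp_apply hu' hψ, hψ2, Finset.smul_sum]
    refine Finset.sum_congr rfl fun a _ => ?_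
    rw [hψ1]
    simp [ψ, smul_smul, sq]
  have hl1 : (Laplacian.laplacian (fun w : Euc n => e (u (c • w)) k) : Euc n → ℝ) z =
      traceHessian ((e ∘ u) ∘ ψ) z k := laplacian_coord hcomp k
  have hl2 : (Laplacian.laplacian (fun w : Euc n => e (u w) k) : Euc n → ℝ) (c • z) =
      traceHessian (e ∘ u) (c • z) k := laplacian_coord hu k
  have hp1 : ∀ a i, partialDeriv a (fun w => e (u (c • w)) i) z =
      (fderiv ℝ ((e ∘ u) ∘ ψ) z (stdVec n a)) i :=
    fun a i => partialDeriv_coord (hcomp.differentiableAt (by simp)) a i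
  have hp2 : ∀ a i, partialDeriv a (fun w => e (u w) i) (c • z) =
      (fderiv ℝ (e ∘ u) (c • z) (stdVec n a)) i :=
    fun a i => partialDeriv_coord (hu.differentiableAt (by simp)) a i
  simp only [tension, hl1, hl2, hp1, hp2, hD, hH, PiLp.smul_apply, smul_eq_mul, mul_add,
    Finset.mul_sum]
  congr 1
  refine Finset.sum_congr rfl fun a _ => Finset.sum_congr rfl fun i _ =>
    Finset.sum_congr rfl fun j _ => ?_
  ring

omit [IsManifold (𝓡 m) ∞ M] in
theorem partialAtZero_comp_smul {u : Euc 2 → M} (hu : MDifferentiableAt (𝓡 2) (𝓡 m) u 0) (c : ℝ)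
    (a : Fin 2) : (partialAtZero (fun z => u (c • z)) a : Euc m) = c • (partialAtZero u a : Euc m) := by
  let ψ : Euc 2 →L[ℝ] Euc 2 := c • ContinuousLinearMap.id ℝ (Euc 2)
  have h0 : ψ 0 = 0 := map_zero ψ
  have hu' : MDifferentiableAt (𝓡 2) (𝓡 m) u (ψ 0) := h0.symm ▸ hu
  have h : mfderiv (𝓡 2) (𝓡 m) (u ∘ ψ) 0 = (mfderiv (𝓡 2) (𝓡 m) u (ψ 0)).comp
    (mfderiv (𝓡 2) (𝓡 2) ψ 0) := mfderiv_comp 0 hu' ψ.differentiableAt.mdifferentiableAt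
  have h1 : mfderiv (𝓡 2) (𝓡 2) ψ 0 = ψ := by
    rw [mfderiv_eq_fderiv]; exact ψ.fderiv
  have hpt : ∀ w v : Euc 2, w = 0 → (mfderiv (𝓡 2) (𝓡 m) u w v : Euc m) =
      mfderiv (𝓡 2) (𝓡 m) u 0 v := by
    rintro w v rfl; rfl
  have h2 : (mfderiv (𝓡 2) (𝓡 m) (u ∘ ψ) 0 (stdVec 2 a) : Euc m) =
      mfderiv (𝓡 2) (𝓡 m) u (ψ 0) (ψ (stdVec 2 a)) := by
    rw [h, h1]; rfl
  have h3 : ψ (stdVec 2 a) = c • stdVec 2 a := rfl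
  refine h2.trans ((hpt _ _ h0).trans ?_)
  rw [h3]
  exact (mfderiv (𝓡 2) (𝓡 m) u 0).map_smul c (stdVec 2 a)

variable {g} {p : M} {X : TangentSpace (𝓡 m) p} {R : ℝ} {u : Euc 2 → M}

theorem IsAdmissibleDisk.comp_smul (h : IsAdmissibleDisk g p X R u) (hR : 0 < R) {c : ℝ}
    (hc : 0 < c) : IsAdmissibleDisk g p (c • X) (R / c) (fun z => u (c • z)) := by
  obtain ⟨⟨hsm, hten⟩, ⟨hc1, hc2⟩, hX⟩ := h
  rw [tangentBundle_mk_eq_iff] at hX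
  have hmem : ∀ z ∈ Metric.ball (0 : Euc 2) (R / c), c • z ∈ Metric.ball (0 : Euc 2) R := by
    intro z hz
    rw [mem_ball_zero_iff] at hz ⊢
    rw [norm_smul, Real.norm_of_nonneg hc.le]
    rwa [lt_div_iff₀' hc] at hz
  have hat : ∀ z ∈ Metric.ball (0 : Euc 2) R, ContMDiffAt (𝓡 2) (𝓡 m) 2 u z := fun z hz =>
    hsm.contMDiffAt (Metric.isOpen_ball.mem_nhds hz)
  have hpar := partialAtZero_comp_smul ((hat 0 (Metric.mem_ball_self hR)).mdifferentiableAt (by simp)) c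
  have h0 : u (c • (0 : Euc 2)) = u 0 := by rw [smul_zero]
  have hin : ∀ a b, g.inner (u (c • (0 : Euc 2))) (partialAtZero (fun z => u (c • z)) a)
      (partialAtZero (fun z => u (c • z)) b) =
      c * (c * g.inner (u 0) (partialAtZero u a) (partialAtZero u b)) := by
    intro a b
    refine (inner_congr g h0 _ _).trans ?_
    rw [hpar, hpar]
    have e1 : g.inner (u 0) (c • partialAtZero u a) (c • partialAtZero u b) =
        c * (c * g.inner (u 0) (partialAtZero u a) (partialAtZero u b)) := by
      rw [map_smul, map_smul]; rfl
    exact e1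
  refine ⟨⟨?_, ?_⟩, ⟨?_, ?_⟩, ?_⟩
  · refine hsm.comp ?_ hmem
    exact (contDiff_const_smul c).contMDiff.contMDiffOn
  · intro e he z hz hze k
    have hcz := hmem z hz
    rw [tension_comp_smul g (contDiffAt_chart_comp he (hat _ hcz) hze),
      hten e he _ hcz hze, mul_zero]
  · rw [hin, hin, hc1]
  · rw [hin, hc2, mul_zero, mul_zero]
  · rw [tangentBundle_mk_eq_iff]
    refine ⟨h0.trans hX.1, ?_⟩
    rw [hpar, hX.2]
    rfl

/-- Rescale by `α` in one direction and by `R = 1 / α` in the other. -/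
theorem unitDiskSet_eq_radiusSet (g : RiemMetric m M) (p : M) (X : TangentSpace (𝓡 m) p) :
    unitDiskSet g p X = radiusSet g p X := by
  ext α
  constructor
  · rintro ⟨hα, u, hu⟩
    refine ⟨1 / α, by positivity, by rw [one_div_one_div], fun z => u (α • z), ?_⟩
    have h := hu.comp_smul one_pos hα
    rwa [smul_inv_smul₀ hα.ne'] at h
  · rintro ⟨R, hR, rfl, u, hu⟩
    refine ⟨by positivity, fun z => u (R • z), ?_⟩
    have h := hu.comp_smul hR hR
    rw [div_self hR.ne'] at h
    rwa [one_div, inv_inv]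

end Scaling

/-! ### Existence of a conformal harmonic disk -/

section Existence

open Set Filter Topology

variable {m : ℕ} {M : Type*} [TopologicalSpace M] [ChartedSpace (Euc m) M]
  [IsManifold (𝓡 m) ∞ M] {e : OpenPartialHomeomorph M (Euc m)} (g : RiemMetric m M)

/-- The quadratic part of the harmonic map system in the chart `e`, with its sign. -/
def christoffelQuadratic (e : OpenPartialHomeomorph M (Euc m)) (x : Euc m × (Euc 2 →L[ℝ] Euc m)) :
    Euc m :=
  ∑ k, (-∑ a : Fin 2, ∑ i : Fin m, ∑ j : Fin m, christoffel g e k i j x.1 *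
    x.2 (stdVec 2 a) i * x.2 (stdVec 2 a) j) • stdVec m k

theorem contDiffOn_christoffelQuadratic (he : e ∈ atlas (Euc m) M) :
    ContDiffOn ℝ ∞ (christoffelQuadratic g e) (e.target ×ˢ univ) := by
  have h1 : ∀ k i j, ContDiffOn ℝ ∞
      (fun x : Euc m × (Euc 2 →L[ℝ] Euc m) => christoffel g e k i j x.1) (e.target ×ˢ univ) :=
    fun k i j => (contDiffOn_christoffel g he k i j).comp contDiffOn_fst fun x hx => hx.1
  have h2 : ∀ (a : Fin 2) (i : Fin m), ContDiffOn ℝ ∞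
      (fun x : Euc m × (Euc 2 →L[ℝ] Euc m) => x.2 (stdVec 2 a) i) (e.target ×ˢ univ) := by
    intro a i
    have : ContDiff ℝ ∞ (fun x : Euc m × (Euc 2 →L[ℝ] Euc m) => x.2 (stdVec 2 a)) :=
      contDiff_snd.clm_apply contDiff_const
    exact ((EuclideanSpace.proj i : Euc m →L[ℝ] ℝ).contDiff.comp this).contDiffOn
  refine ContDiffOn.sum fun k _ => ?_
  have h3 : ContDiffOn ℝ ∞ (fun x : Euc m × (Euc 2 →L[ℝ] Euc m) => ∑ a : Fin 2, ∑ i : Fin m,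
      ∑ j : Fin m, christoffel g e k i j x.1 * x.2 (stdVec 2 a) i * x.2 (stdVec 2 a) j)
      (e.target ×ˢ univ) := ContDiffOn.sum fun a _ => ContDiffOn.sum fun i _ =>
    ContDiffOn.sum fun j _ => ((h1 k i j).mul (h2 a i)).mul (h2 a j)
  exact h3.neg.smul contDiffOn_const

theorem christoffelQuadratic_apply (x : Euc m × (Euc 2 →L[ℝ] Euc m)) (k : Fin m) :
    christoffelQuadratic g e x k = -∑ a : Fin 2, ∑ i : Fin m, ∑ j : Fin m,
      christoffel g e k i j x.1 * x.2 (stdVec 2 a) i * x.2 (stdVec 2 a) j := by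
  simp [christoffelQuadratic, stdVec, Finset.sum_apply, Pi.single_apply]

theorem christoffelQuadratic_smul (y : Euc m) (A : Euc 2 →L[ℝ] Euc m) (t : ℝ) :
    christoffelQuadratic g e (y, t • A) = t ^ 2 • christoffelQuadratic g e (y, A) := by
  ext k
  rw [PiLp.smul_apply, christoffelQuadratic_apply, christoffelQuadratic_apply, smul_eq_mul, mul_neg]
  simp only [Finset.mul_sum, smul_apply, PiLp.smul_apply, smul_eq_mul]
  congr 1
  refine Finset.sum_congr rfl fun a _ => Finset.sum_congr rfl fun i _ =>
    Finset.sum_congr rfl fun j _ => ?_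
  ring

theorem tension_symm_comp_eq_zero {U : Euc 2 → Euc m}
    {z : Euc 2} (hU : ContDiffAt ℝ 2 U z) (hz : U z ∈ e.target)
    (h : traceHessian U z = christoffelQuadratic g e (U z, fderiv ℝ U z)) (k : Fin m) :
    tension g e (e.symm ∘ U) k z = 0 := by
  have heq : ∀ᶠ w in 𝓝 z, e ((e.symm ∘ U) w) = U w := by
    filter_upwards [hU.continuousAt.preimage_mem_nhds (e.open_target.mem_nhds hz)] with w hw
    exact e.right_inv hw
  have hk : ∀ k : Fin m, (fun w => e ((e.symm ∘ U) w) k) =ᶠ[𝓝 z] fun w => U w k := fun k => by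
    filter_upwards [heq] with w hw
    rw [hw]
  have hl : (Laplacian.laplacian (fun w : Euc 2 => e ((e.symm ∘ U) w) k) : Euc 2 → ℝ) z =
      traceHessian U z k :=
    (InnerProductSpace.laplacian_congr_nhds (hk k)).self_of_nhds.trans (laplacian_coord hU k)
  have hp : ∀ a i, partialDeriv a (fun w => e ((e.symm ∘ U) w) i) z =
      (fderiv ℝ U z (stdVec 2 a)) i := fun a i => by
    rw [← partialDeriv_coord (hU.differentiableAt (by simp)), partialDeriv, partialDeriv,
      (hk i).fderiv_eq]
  simp only [tension, hl, hp, heq.self_of_nhds]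
  rw [h, christoffelQuadratic_apply]
  exact neg_add_cancel _

/-- Local existence of harmonic maps with prescribed `1`-jet, up to a scale. -/
theorem exists_isHarmonicMapOn (he : e ∈ atlas (Euc m) M) {y₀ : Euc m} (hy₀ : y₀ ∈ e.target)
    (l : Euc 2 →L[ℝ] Euc m) : ∃ ε > (0 : ℝ), ∃ U : Euc 2 → Euc m, ContDiff ℝ 2 U ∧ U 0 = y₀ ∧
      fderiv ℝ U 0 = ε • l ∧ IsHarmonicMapOn g (e.symm ∘ U) (Metric.ball 0 1) := by
  obtain ⟨ε, hε, U, hU, hU0, hUl, hUz⟩ := exists_solution_quadratic e.open_target hy₀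
    (contDiffOn_christoffelQuadratic g he) (christoffelQuadratic_smul g) l
  have hsm : ContMDiffOn (𝓡 2) (𝓡 m) 2 (e.symm ∘ U) (Metric.ball 0 1) :=
    ((contMDiffOn_chart_symm he).of_le (by norm_cast)).comp hU.contMDiff.contMDiffOn
      fun z hz => (hUz z hz).1
  refine ⟨ε, hε, U, hU, hU0, hUl, hsm, fun e' he' z hz hze' k => ?_⟩
  -- The system was solved in the chart `e` alone; invariance carries it to every other chart.
  exact tension_eq_zero_of_tension_eq_zero g he' he
    (hsm.contMDiffAt (Metric.isOpen_ball.mem_nhds hz)) hze' (e.map_target (hUz z hz).1)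
    (tension_symm_comp_eq_zero g hU.contDiffAt (hUz z hz).1 (hUz z hz).2) k

/-- This is where `m ≠ 1` enters: a nonzero `x` spans only a line, so some vector lies off it, and
Gram–Schmidt followed by a normalization gives `w`. -/
theorem exists_orthogonal_same_length (hm : m ≠ 1) (he : e ∈ atlas (Euc m) M) {y : Euc m}
    (hy : y ∈ e.target) {x : Euc m} (hx : x ≠ 0) :
    ∃ w, chartForm g e y x x = chartForm g e y w w ∧ chartForm g e y x w = 0 := by
  obtain ⟨v, hv⟩ : ∃ v : Euc m, ∀ t : ℝ, t • x ≠ v := by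
    by_contra! h
    have := finrank_eq_one x hx h
    rw [finrank_euclideanSpace_fin] at this
    exact hm this
  have hxx := chartForm_pos g he hy hx
  set G := chartForm g e y with hG
  have hs : ∀ a b, G a b = G b a := fun a b => chartForm_symm g y a b
  let w := v - (G x v / G x x) • x
  have hw : w ≠ 0 := fun h => hv _ (sub_eq_zero.1 h).symm
  have hww : 0 < G w w := chartForm_pos g he hy hw
  have hxw : G x w = 0 := by
    simp only [w, map_sub, map_smul, smul_eq_mul]
    field_simp
    ring
  refine ⟨Real.sqrt (G x x / G w w) • w, ?_, ?_⟩
  · rw [map_smul, map_smul, smul_apply, smul_eq_mul, smul_eq_mul, ← mul_assoc,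
      Real.mul_self_sqrt (by positivity), div_mul_cancel₀ _ hww.ne']
  · rw [map_smul, hxw, smul_zero]

theorem radiusSet_nonempty (hm : m ≠ 1) (p : M) {X : TangentSpace (𝓡 m) p} (hX : X ≠ 0) :
    (radiusSet g p X).Nonempty := by
  let e := chartAt (Euc m) p
  have he : e ∈ atlas (Euc m) M := chart_mem_atlas _ p
  have hp : p ∈ e.source := mem_chart_source _ p
  have hy : e p ∈ e.target := e.map_source hp
  let x : Euc m := mfderiv (𝓡 m) (𝓡 m) e p X
  have hxX : (mfderiv (𝓡 m) (𝓡 m) e.symm (e p) x : Euc m) = X :=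
    mfderiv_chart_symm_mfderiv_chart he hp X
  have hx : x ≠ 0 := by
    intro h
    apply hX
    have h2 : (X : Euc m) = 0 := by
      rw [← hxX, h]
      exact (mfderiv (𝓡 m) (𝓡 m) e.symm (e p)).map_zero
    exact h2
  obtain ⟨w, hw1, hw2⟩ := exists_orthogonal_same_length g hm he hy hx
  -- Sending `∂/∂x` to `x` and `∂/∂y` to `w` makes `l`, and every multiple of it, conformal.
  let l : Euc 2 →L[ℝ] Euc m := (EuclideanSpace.proj 0 : Euc 2 →L[ℝ] ℝ).smulRight x +
    (EuclideanSpace.proj 1 : Euc 2 →L[ℝ] ℝ).smulRight w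
  have hl0 : l (stdVec 2 0) = x := by simp [l, stdVec]
  have hl1 : l (stdVec 2 1) = w := by simp [l, stdVec]
  obtain ⟨ε, hε, U, hU, hU0, hUl, hharm⟩ := exists_isHarmonicMapOn g he hy l
  have hUt : U 0 ∈ e.target := hU0 ▸ hy
  have hd : mfderiv (𝓡 2) (𝓡 m) (e.symm ∘ U) 0 = (mfderiv (𝓡 m) (𝓡 m) e.symm (U 0)).comp
      (mfderiv (𝓡 2) (𝓡 m) U 0) := mfderiv_comp 0 (mdifferentiableAt_chart_symm he hUt)
    (hU.differentiable (by simp) 0).mdifferentiableAt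
  have hpar : ∀ a, (partialAtZero (e.symm ∘ U) a : Euc m) =
      mfderiv (𝓡 m) (𝓡 m) e.symm (U 0) (ε • l (stdVec 2 a)) := fun a => by
    rw [partialAtZero, hd, mfderiv_eq_fderiv, hUl]; rfl
  have hin : ∀ a b, g.inner ((e.symm ∘ U) 0) (partialAtZero (e.symm ∘ U) a)
      (partialAtZero (e.symm ∘ U) b) = ε * (ε * chartForm g e (e p) (l (stdVec 2 a))
        (l (stdVec 2 b))) := by
    intro a b
    have h1 : g.inner ((e.symm ∘ U) 0) (partialAtZero (e.symm ∘ U) a)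
      (partialAtZero (e.symm ∘ U) b) = chartForm g e (U 0) (ε • l (stdVec 2 a))
        (ε • l (stdVec 2 b)) := by
      rw [hpar, hpar]; rfl
    rw [h1, hU0, map_smul, map_smul]
    rfl
  have hadm : IsAdmissibleDisk g p (ε • X) 1 (e.symm ∘ U) := by
    refine ⟨hharm, ⟨?_, ?_⟩, ?_⟩
    · rw [hin, hin, hl0, hl1, hw1]
    · rw [hin, hl0, hl1, hw2, mul_zero, mul_zero]
    · rw [tangentBundle_mk_eq_iff]
      refine ⟨?_, ?_⟩
      · rw [Function.comp_apply, hU0]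
        exact e.left_inv hp
      · rw [hpar, hl0, hU0]
        refine ((mfderiv (𝓡 m) (𝓡 m) e.symm (e p)).map_smul ε x).trans ?_
        exact congrArg (fun v : Euc m => ε • v) hxX
  have h := hadm.comp_smul one_pos (inv_pos.2 hε)
  rw [inv_smul_smul₀ hε.ne'] at h
  -- The unit disk with derivative `ε • X`, rescaled by `ε⁻¹`, has derivative `X` and radius `1 /
  -- ε⁻¹`, that is, `ε`.
  exact ⟨_, 1 / ε⁻¹, by positivity, rfl, _, h⟩

end Existence

theorem extInf_nonneg {S : Set ℝ} (hS : ∀ t ∈ S, 0 ≤ t) : 0 ≤ extInf S := by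
  refine le_sInf ?_
  rintro _ ⟨t, ht, rfl⟩
  exact EReal.coe_nonneg.2 (hS t ht)

theorem extInf_lt_top {S : Set ℝ} (hS : S.Nonempty) : extInf S < ⊤ := by
  obtain ⟨t, ht⟩ := hS
  exact (sInf_le (Set.mem_image_of_mem _ ht)).trans_lt (EReal.coe_lt_top t)

end RealKobayashi
end

theorem mainTheorem3 {m : ℕ} (hm : m ≠ 1) {M : Type*} [TopologicalSpace M]
    [ChartedSpace (RealKobayashi.Euc m) M] [IsManifold (𝓡 m) ∞ M]
    (g : RealKobayashi.RiemMetric m M) (p : M) (X : TangentSpace (𝓡 m) p) :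
    (X ≠ 0 → RealKobayashi.extInf (RealKobayashi.unitDiskSet g p X)
        = RealKobayashi.extInf (RealKobayashi.radiusSet g p X)) ∧
      0 ≤ RealKobayashi.kobayashiMetric g p X ∧
      RealKobayashi.kobayashiMetric g p X < ⊤ := by
  refine ⟨fun _ => by rw [RealKobayashi.unitDiskSet_eq_radiusSet], ?_⟩
  by_cases hX : X = 0
  · simp [RealKobayashi.kobayashiMetric, hX]
  · rw [RealKobayashi.kobayashiMetric, if_neg hX]
    refine ⟨RealKobayashi.extInf_nonneg ?_,
      RealKobayashi.extInf_lt_top (RealKobayashi.radiusSet_nonempty g hm p hX)⟩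
    rintro _ ⟨R, hR, rfl, _⟩
    positivity
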